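/- All graphs are finite and simple. A graph is \emph{subcubic} if it is connected and has maximum degree at most $3$. Two disjoint sets of vertices of a graph $G$ form a \emph{connected coalition} if neither of them is a connected dominating set of $G$ but their union is. A \emph{connected coalition partition} of $G$ is a partition $\pi$ of $V(G)$ such that each member of $\pi$ is either a connected dominating set consisting of a single vertex or forms a connected coalition with some member of $\pi$. The \emph{coalition graph} $CCG(G,\pi)$ has the members of $\pi$ as its vertices, two of them being adjacent if and only if they form a connected coalition. A subcubic graph $G$ \emph{defines} a graph $H$ if $H\cong CCG(G,\pi)$ for some connected coalition partition $\pi$ of $G$. Graphs are counted up to isomorphism. The M\"obius ladder $M_n$ ($n$ even) is the $n$-cycle with all pairs of opposite vertices joined. \textbf{Theorem.} (1) Each of the graphs $K_1$, $\overline{K}_2$, $\overline{K}_3$, $K_4$, $\overline{K}_4$, $C_5$, $3K_2$, $K_{2,3}$ and $K_{3,3}$ is defined by at least one subcubic graph, and every subcubic graph that defines it has order at most $10$; hence it is defined by only finitely many subcubic graphs. (2) Each of the following graphs is defined by infinitely many subcubic graphs, among them the M\"obius ladder $M_n$ for every even $n\ge 10$: $C_3$; $2K_2$; $P_4$; $C_4$;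 $C_3+e$ (a triangle with one pendant edge); $K_4-e$; $P_2\cup P_3$; $S_{1,2}$ (two adjacent vertices, one with one further pendant neighbour, the other with two); $P_5$; $C_3+e+e$ (a triangle with one pendant edge at each of two of its vertices); $C_3+2e$ (a triangle with two pendant edges at one of its vertices); and $S_{2,2}$ (two adjacent vertices, each with two further pendant neighbours). (3) The graph $C_4+e$ (a $4$-cycle with one pendant edge) is defined by infinitely many subcubic graphs; among them there is, for every even $n\ge 10$, one on the vertex set of $M_n$ whose edge set differs from that of $M_n$ in a number of edges that is bounded independently of $n$. (4) For every $k\ge 2$, the star $S_k$ of order $k$ is defined by infinitely many subcubic graphs. Moreover, infinitely many subcubic graphs $G$ define it through a partition $\{V_1\cup V_2,\{v_1\},\dots,\{v_{k-1}\}\}$ with centre $V_1\cup V_2$, where $V_1$ and $V_2$ are disjoint and induce connected subgraphs, no edge of $G$ joins $V_1$ to $V_2$, each $v_i$ has neighbours both in $V_1$ and in $V_2$, and $V_1\cup V_2$ forms a connected coalition with each $\{v_i\}$. -/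

import Mathlib

open SimpleGraph

universe u

namespace CoalitionGraphs

/-- A subcubic graph: connected, with maximum degree at most `3`. -/
def IsSubcubic {V : Type*} (G : SimpleGraph V) : Prop :=
  G.Connected ∧ ∀ v, (G.neighborSet v).encard ≤ 3

/-- `D` is a dominating set and the subgraph induced by `D` is connected (so `D` is nonempty). -/
def IsConnDominating {V : Type*} (G : SimpleGraph V) (D : Set V) : Prop :=
  (∀ v, v ∉ D → ∃ u ∈ D, G.Adj v u) ∧ (G.induce D).Connected

/-- Two disjoint vertex sets form a connected coalition: neither is a connected dominating set,
their union is one. -/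
def IsCoalition {V : Type*} (G : SimpleGraph V) (A B : Set V) : Prop :=
  Disjoint A B ∧ ¬ IsConnDominating G A ∧ ¬ IsConnDominating G B ∧ IsConnDominating G (A ∪ B)

/-- A connected coalition partition: a partition of the vertex set (into nonempty sets), each
member of which is a connected dominating set consisting of a single vertex, or forms a
connected coalition with some member. -/
def IsCoalitionPartition {V : Type*} (G : SimpleGraph V) (π : Set (Set V)) : Prop :=
  Setoid.IsPartition π ∧
    ∀ A ∈ π, ((∃ v, A = {v}) ∧ IsConnDominating G A) ∨ ∃ B ∈ π, IsCoalition G A B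

/-- The coalition graph of `G` and `π`: its vertices are the members of `π`, and two of them are
adjacent iff they form a connected coalition. -/
def coalitionGraph {V : Type*} (G : SimpleGraph V) (π : Set (Set V)) : SimpleGraph π where
  Adj A B := IsCoalition G A B
  symm := ⟨fun A B h => ⟨h.1.symm, h.2.2.1, h.2.1, by rw [Set.union_comm]; exact h.2.2.2⟩⟩
  loopless := ⟨fun A h => h.2.1 (by simpa using h.2.2.2)⟩

/-- `G` is a subcubic graph that defines the coalition graph `H` (up to isomorphism). -/
def Defines {V W : Type*} (G : SimpleGraph V) (H : SimpleGraph W) : Prop :=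
  IsSubcubic G ∧
    ∃ π : Set (Set V), IsCoalitionPartition G π ∧ Nonempty (coalitionGraph G π ≃g H)

/-! ### Counting finite graphs up to isomorphism -/

/-- Finite graphs on the vertex sets `Fin n`, up to isomorphism. -/
def graphSetoid : Setoid (Σ n : ℕ, SimpleGraph (Fin n)) where
  r G H := Nonempty (G.2 ≃g H.2)
  iseqv := ⟨fun _ => ⟨RelIso.refl _⟩, fun ⟨e⟩ => ⟨e.symm⟩, fun ⟨e⟩ ⟨f⟩ => ⟨e.trans f⟩⟩

/-- Isomorphism classes of finite graphs. -/
def GraphClass : Type := Quotient graphSetoid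

/-- The isomorphism class of a graph on `Fin n`. -/
def graphClass {n : ℕ} (G : SimpleGraph (Fin n)) : GraphClass :=
  Quotient.mk graphSetoid ⟨n, G⟩

/-- The isomorphism classes of the finite subcubic graphs that define `H`. -/
def definingClasses {W : Type*} (H : SimpleGraph W) : Set GraphClass :=
  {c | ∃ (n : ℕ) (G : SimpleGraph (Fin n)), c = graphClass G ∧ Defines G H}

/-- `H` is defined by at least one finite subcubic graph, every such graph has order at most
`10`, and there are only finitely many of them up to isomorphism. -/
def FinitelyDefined {W : Type} (H : SimpleGraph W) : Prop :=
  (definingClasses H).Nonempty ∧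
    (∀ (V : Type u) [Finite V] (G : SimpleGraph V), Defines G H → Nat.card V ≤ 10) ∧
    (definingClasses H).Finite

/-- `H` is defined by infinitely many pairwise non-isomorphic finite subcubic graphs. -/
def InfinitelyDefined {W : Type} (H : SimpleGraph W) : Prop :=
  (definingClasses H).Infinite

/-! ### The families of defining graphs -/

/-- The Möbius ladder of (even) order `n`: the cycle of order `n` with opposite vertices joined. -/
def mobiusLadder (n : ℕ) : SimpleGraph (ZMod n) :=
  circulantGraph {1, ((n / 2 : ℕ) : ZMod n)}

/-- Infinitely many subcubic graphs define `H`, among them every Möbius ladder of even order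
`n ≥ 10`. -/
def DefinedByMobiusLadders {W : Type} (H : SimpleGraph W) : Prop :=
  InfinitelyDefined H ∧ ∀ n : ℕ, 10 ≤ n → Even n → Defines (mobiusLadder n) H

/-- Infinitely many subcubic graphs define `H`, among them, for every even `n ≥ 10`, one that
arises from the Möbius ladder of order `n` by removing and adding edges, where the number of
these edges is bounded independently of `n`. -/
def DefinedByModifiedMobiusLadders {W : Type} (H : SimpleGraph W) : Prop :=
  InfinitelyDefined H ∧ ∃ c : ℕ, ∀ n : ℕ, 10 ≤ n → Even n →
    ∃ G : SimpleGraph (ZMod n),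
      (symmDiff G.edgeSet (mobiusLadder n).edgeSet).encard ≤ c ∧ Defines G H

/-- The star of order `k`, with centre `0`. -/
def star (k : ℕ) : SimpleGraph (Fin k) :=
  SimpleGraph.fromRel fun i _ => i.val = 0

/-- `G` has a connected coalition partition `{V₁ ∪ V₂, {v₁}, …, {vₖ₋₁}}` whose coalition graph is
the star of order `k`, with centre `V₁ ∪ V₂`; here `V₁` and `V₂` are disjoint sets that induce
connected subgraphs, no edge joins `V₁` and `V₂`, and each vertex `vᵢ` has a neighbour in `V₁`
and a neighbour in `V₂`. -/
def DefinesStarByPair {V : Type*} (G : SimpleGraph V) (k : ℕ) : Prop :=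
  ∃ (V₁ V₂ : Set V) (v : Fin (k - 1) → V),
    Disjoint V₁ V₂ ∧ (G.induce V₁).Connected ∧ (G.induce V₂).Connected ∧
    (∀ x ∈ V₁, ∀ y ∈ V₂, ¬ G.Adj x y) ∧
    Function.Injective v ∧ (∀ i, v i ∉ V₁ ∪ V₂) ∧
    (∀ i, (∃ x ∈ V₁, G.Adj (v i) x) ∧ ∃ y ∈ V₂, G.Adj (v i) y) ∧
    (∀ i, IsCoalition G (V₁ ∪ V₂) {v i}) ∧
    IsCoalitionPartition G (insert (V₁ ∪ V₂) (Set.range fun i => {v i})) ∧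
    Nonempty (coalitionGraph G (insert (V₁ ∪ V₂) (Set.range fun i => {v i})) ≃g star k)

/-- The isomorphism classes of the finite subcubic graphs that define the star of order `k`
through a partition as in `DefinesStarByPair`. -/
def starClasses (k : ℕ) : Set GraphClass :=
  {c | ∃ (n : ℕ) (G : SimpleGraph (Fin n)),
    c = graphClass G ∧ IsSubcubic G ∧ DefinesStarByPair G k}

/-! ### The coalition graphs -/

/-- The graph on `Fin k` whose edges are listed in `E`. -/
abbrev graphOn (k : ℕ) (E : Set (Sym2 (Fin k))) : SimpleGraph (Fin k) := fromEdgeSet E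

/-- The edgeless graph of order `k`, the complement of the complete graph. -/
abbrev edgeless (k : ℕ) : SimpleGraph (Fin k) := (completeGraph (Fin k))ᶜ

/-- `2K₂`. -/
abbrev twoK2 := graphOn 4 {s(0, 1), s(2, 3)}
/-- `3K₂`. -/
abbrev threeK2 := graphOn 6 {s(0, 1), s(2, 3), s(4, 5)}
/-- `C₃ + e`: a triangle with one pendant edge. -/
abbrev C3e := graphOn 4 {s(0, 1), s(1, 2), s(2, 0), s(0, 3)}
/-- `K₄ - e`: the complete graph of order `4` without one edge. -/
abbrev K4MinusE := (completeGraph (Fin 4)).deleteEdges {s(0, 1)}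
/-- `P₂ ∪ P₃`: the disjoint union of the paths of orders `2` and `3`. -/
abbrev P2UnionP3 := pathGraph 2 ⊕g pathGraph 3
/-- `S_{1,2}`: two adjacent vertices, one with one pendant neighbour, the other with two. -/
abbrev S12 := graphOn 5 {s(0, 1), s(0, 2), s(1, 3), s(1, 4)}
/-- `S_{2,2}`: two adjacent vertices, each with two pendant neighbours. -/
abbrev S22 := graphOn 6 {s(0, 1), s(0, 2), s(0, 3), s(1, 4), s(1, 5)}
/-- `C₃ + e + e`: a triangle with one pendant edge at each of two of its vertices. -/
abbrev C3ee := graphOn 5 {s(0, 1), s(1, 2), s(2, 0), s(0, 3), s(1, 4)}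
/-- `C₃ + 2e`: a triangle with two pendant edges at one of its vertices. -/
abbrev C32e := graphOn 5 {s(0, 1), s(1, 2), s(2, 0), s(0, 3), s(0, 4)}
/-- `C₄ + e`: a cycle of order `4` with one pendant edge. -/
abbrev C4e := graphOn 5 {s(0, 1), s(1, 2), s(2, 3), s(3, 0), s(0, 4)}

end CoalitionGraphs

/-! A partition into parts named by the vertices of `H` is a surjective colouring `V → W`, so
everything is phrased with colourings (`defines_iff_exists_coloring`).

Infinite families from Möbius ladders. In the ladder of order `2 * s + 10`, contract `s + 1`
consecutive vertices of each rail, opposite each other, to single vertices `0` and `5`; the result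
is the ladder of order `10`. Pulling back along such a contraction preserves and reflects
connectedness of vertex sets. Domination always descends to the quotient. It ascends for sets
containing `0` or `5`, since every vertex of one contracted segment is joined by a rung to the other
segment (`IsContraction`). Hence a colouring of the ladder of order `10` lifts to all longer ones as
soon as the colours of `0` and `5` cover all edges of `H`, and only finite checks remain. They are
carried out by a verified search procedure. A swap of two edges away from the contracted segments
does not disturb the argument; this gives `C4e`.

Finite cases. In a subcubic graph of order `n`, a connected dominating set `D` spans at least `|D| -
1` edges, so at most `|D| + 2` edges leave it and `n ≤ 2|D| + 2`. Summing this over the edges of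
`C₅`, of `3K₂` or of a perfect matching of `K_{3,3}` bounds `n`. For `K₄` and `K_{2,3}` the sum does
not suffice, and the edges inside and between the colour classes are counted as well. If `H` has no
edges, all parts are singletons, so the order of `G` is that of `H`; complete graphs of order at
most `4` are examples.

Stars. Take two long paths and further vertices, each joined to both paths. The union of the paths
is dominating but disconnected, and any single further vertex connects it, while two further
vertices never dominate. -/

namespace CoalitionGraphs

/-! ### Partitions as colourings -/

section General

variable {V : Type*} {W : Type*} {G : SimpleGraph V}

/-- A graph with a connected dominating set is connected. -/
theorem IsConnDominating.connected {D : Set V} (h : IsConnDominating G D) : G.Connected := by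
  obtain ⟨hd, hc⟩ := h
  obtain ⟨⟨r, hr⟩⟩ := hc.nonempty
  have key : ∀ v, G.Reachable v r := by
    intro v
    by_cases hv : v ∈ D
    · exact (hc.preconnected ⟨v, hv⟩ ⟨r, hr⟩).map (Embedding.induce D).toHom
    · obtain ⟨u, hu, hvu⟩ := hd v hv
      exact hvu.reachable.trans
        ((hc.preconnected ⟨u, hu⟩ ⟨r, hr⟩).map (Embedding.induce D).toHom)
  have : Nonempty V := ⟨r⟩
  exact ⟨fun a b => (key a).trans (key b).symm⟩

/-- The coalition graph of an injectively indexed partition. -/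
theorem nonempty_iso_coalitionGraph_range {H : SimpleGraph W} {P : W → Set V}
    (hP : Function.Injective P) (hadj : ∀ i j, H.Adj i j ↔ IsCoalition G (P i) (P j)) :
    Nonempty (coalitionGraph G (Set.range P) ≃g H) := by
  refine ⟨RelIso.symm ⟨Equiv.ofInjective P hP, ?_⟩⟩
  intro i j
  exact (hadj i j).symm

/-- The colour of a vertex is the image under the isomorphism of the part that contains it;
conversely, the parts are the fibres. Surjectivity encodes that parts are nonempty. -/
theorem defines_iff_exists_coloring {H : SimpleGraph W} :
    Defines G H ↔ IsSubcubic G ∧ ∃ c : V → W, Function.Surjective c ∧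
      (∀ i j, H.Adj i j ↔ IsCoalition G (c ⁻¹' {i}) (c ⁻¹' {j})) ∧
      ∀ i, ((∃ v, c ⁻¹' {i} = {v}) ∧ IsConnDominating G (c ⁻¹' {i})) ∨ ∃ j, H.Adj i j := by
  refine and_congr_right fun _ => ⟨?_, ?_⟩
  · rintro ⟨π, ⟨hπ, hmem⟩, ⟨e⟩⟩
    have hex : ∀ v, ∃ A : π, v ∈ A.1 := fun v => by
      obtain ⟨A, ⟨hA, hv⟩, -⟩ := hπ.2 v
      exact ⟨⟨A, hA⟩, hv⟩
    choose p hp using hex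
    have huniq : ∀ (v) (A : π), v ∈ A.1 → p v = A := fun v A hA => by
      obtain ⟨B, -, hB⟩ := hπ.2 v
      exact Subtype.ext ((hB _ ⟨(p v).2, hp v⟩).trans (hB _ ⟨A.2, hA⟩).symm)
    have hfib : ∀ i, (fun v => e (p v)) ⁻¹' {i} = (e.symm i).1 := by
      intro i
      ext v
      simp only [Set.mem_preimage, Set.mem_singleton_iff]
      constructor
      · rintro rfl
        simpa using hp v
      · intro h
        rw [huniq v _ h]
        simp
    refine ⟨fun v => e (p v), ?_, ?_, ?_⟩
    · intro i
      have hne : (e.symm i).1 ≠ ∅ := fun h => hπ.1 (h ▸ (e.symm i).2)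
      obtain ⟨v, hv⟩ := Set.nonempty_iff_ne_empty.2 hne
      refine ⟨v, ?_⟩
      show e (p v) = i
      rw [huniq v _ hv]
      simp
    · intro i j
      rw [hfib, hfib]
      exact (e.symm.map_adj_iff (v := i) (w := j)).symm
    · intro i
      rw [hfib]
      refine (hmem _ (e.symm i).2).imp id ?_
      rintro ⟨B, hB, h⟩
      refine ⟨e ⟨B, hB⟩, ?_⟩
      rw [← e.symm.map_adj_iff]
      show IsCoalition G (e.symm i).1 (e.symm (e ⟨B, hB⟩)).1
      rwa [e.symm_apply_apply]
  · rintro ⟨c, hc, hadj, hmem⟩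
    have hinj : Function.Injective fun i => c ⁻¹' {i} := fun i j h => by
      obtain ⟨v, rfl⟩ := hc i
      have : v ∈ c ⁻¹' {j} := by
        rw [← show c ⁻¹' {c v} = c ⁻¹' {j} from h]
        rfl
      exact this
    refine ⟨Set.range fun i => c ⁻¹' {i}, ⟨⟨?_, ?_⟩, ?_⟩,
      nonempty_iso_coalitionGraph_range hinj hadj⟩
    · rintro ⟨i, hi⟩
      obtain ⟨v, rfl⟩ := hc i
      exact (Set.eq_empty_iff_forall_notMem.1 hi v) rfl
    · intro v
      refine ⟨c ⁻¹' {c v}, ⟨⟨c v, rfl⟩, rfl⟩, ?_⟩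
      rintro _ ⟨⟨i, rfl⟩, hi⟩
      have : c v = i := hi
      rw [this]
    · rintro _ ⟨i, rfl⟩
      refine (hmem i).imp id ?_
      rintro ⟨j, hj⟩
      exact ⟨_, ⟨j, rfl⟩, (hadj i j).1 hj⟩

/-- An interval of `Fin n` induces a connected graph if its successive members are adjacent. -/
theorem preconnected_induce_Icc {n : ℕ} {G : SimpleGraph (Fin n)} {lo hi : ℕ}
    (h : ∀ x y : Fin n, x.val + 1 = y.val → lo ≤ x.val → y.val ≤ hi → G.Adj x y) :
    (G.induce {x : Fin n | lo ≤ x.val ∧ x.val ≤ hi}).Preconnected := by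
  have key : ∀ (k : ℕ) (x y : {x : Fin n | lo ≤ x.val ∧ x.val ≤ hi}),
      x.1.val + k = y.1.val → (G.induce {x : Fin n | lo ≤ x.val ∧ x.val ≤ hi}).Reachable x y := by
    intro k
    induction k with
    | zero =>
      intro x y hxy
      have : x = y := Subtype.ext (Fin.ext (by simpa using hxy))
      rw [this]
    | succ k ih =>
      intro x y hxy
      have hx := x.2
      have hy := y.2
      simp only [Set.mem_ofPred_eq] at hx hy
      have hyn := y.1.isLt
      let z : {x : Fin n | lo ≤ x.val ∧ x.val ≤ hi} :=
        ⟨⟨x.1.val + 1, by omega⟩, by simp only [Set.mem_ofPred_eq]; omega⟩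
      have hxz : (G.induce {x : Fin n | lo ≤ x.val ∧ x.val ≤ hi}).Adj x z :=
        h x.1 z.1 rfl hx.1 (by show x.1.val + 1 ≤ hi; omega)
      exact hxz.reachable.trans (ih z y (by show x.1.val + 1 + k = _; omega))
  intro x y
  rcases le_total x.1.val y.1.val with hle | hle
  · exact key _ x y (Nat.add_sub_of_le hle)
  · exact (key _ y x (Nat.add_sub_of_le hle)).symm

end General

/-! ### Lifting coalition partitions along contractions -/

section Contraction

variable {V W : Type*} {G : SimpleGraph V} {G' : SimpleGraph W}

/-- `f` contracts `G` to `G'`: it maps edges to edges or vertices, its fibres are connected, all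
edges of `G'` lift to edges at every vertex of the fibre, with the possible exception of edges
from one of the adjacent vertices `t` and `b` to the other vertices. -/
structure IsContraction (G : SimpleGraph V) (G' : SimpleGraph W) (f : V → W) (t b : W) : Prop where
  surjective : Function.Surjective f
  preconnected_fiber : ∀ w, (G.induce (f ⁻¹' {w})).Preconnected
  map_adj : ∀ {x y}, G.Adj x y → f x = f y ∨ G'.Adj (f x) (f y)
  adj : G'.Adj t b
  lift_adj : ∀ {x w}, G'.Adj (f x) w → (f x ≠ t ∧ f x ≠ b) ∨ w = t ∨ w = b →
    ∃ y, f y = w ∧ G.Adj x y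

variable {f : V → W} {t b : W} (hf : IsContraction G G' f t b)
include hf

/-- An edge that need not lift at its first end, which is then `t` or `b`, lifts at the other end.
-/
theorem IsContraction.exists_adj_of_adj {v w : W} (h : G'.Adj v w) :
    ∃ x y, f x = v ∧ f y = w ∧ G.Adj x y := by
  by_cases hc : (v ≠ t ∧ v ≠ b) ∨ w = t ∨ w = b
  · obtain ⟨x, rfl⟩ := hf.surjective v
    obtain ⟨y, hy, hxy⟩ := hf.lift_adj h hc
    exact ⟨x, y, rfl, hy, hxy⟩
  · obtain ⟨y, rfl⟩ := hf.surjective w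
    obtain ⟨x, hx, hxy⟩ := hf.lift_adj h.symm (by tauto)
    exact ⟨x, y, hx, rfl, hxy.symm⟩

/-- Walks project because edges go to edges or to points. They lift because each edge lifts
somewhere and the connected fibres bridge the gaps between consecutive lifts. -/
theorem IsContraction.connected_iff {D : Set W} :
    (G.induce (f ⁻¹' D)).Connected ↔ (G'.induce D).Connected := by
  constructor
  · intro h
    obtain ⟨⟨r, hr⟩⟩ := h.nonempty
    have : Nonempty D := ⟨⟨f r, hr⟩⟩
    refine ⟨?_⟩
    have key : ∀ x y : (f ⁻¹' D : Set V), (G.induce (f ⁻¹' D)).Reachable x y →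
        (G'.induce D).Reachable ⟨f x, x.2⟩ ⟨f y, y.2⟩ := by
      intro x y hxy
      rw [reachable_iff_reflTransGen] at hxy
      induction hxy with
      | refl => exact Reachable.refl _
      | @tail p q _ hpq ih =>
        refine ih.trans ?_
        rcases hf.map_adj (show G.Adj p.1 q.1 from hpq) with heq | hadj
        · have heq' : (⟨f p, p.2⟩ : D) = ⟨f q, q.2⟩ := Subtype.ext heq
          rw [heq']
        · exact Adj.reachable (show (G'.induce D).Adj ⟨f p, p.2⟩ ⟨f q, q.2⟩ from hadj)
    rintro ⟨v, hv⟩ ⟨w, hw⟩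
    obtain ⟨x, rfl⟩ := hf.surjective v
    obtain ⟨y, rfl⟩ := hf.surjective w
    exact key ⟨x, hv⟩ ⟨y, hw⟩ (h.preconnected _ _)
  · intro h
    obtain ⟨⟨r, hr⟩⟩ := h.nonempty
    obtain ⟨r, rfl⟩ := hf.surjective r
    have : Nonempty (f ⁻¹' D : Set V) := ⟨⟨r, hr⟩⟩
    refine ⟨?_⟩
    have fib : ∀ x y : (f ⁻¹' D : Set V), f x = f y → (G.induce (f ⁻¹' D)).Reachable x y := by
      rintro ⟨x, hx⟩ ⟨y, hy⟩ hxy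
      have hsub : f ⁻¹' {f y} ⊆ f ⁻¹' D := by
        intro z hz
        have : f z = f y := hz
        show f z ∈ D
        rw [this]
        exact hy
      exact (hf.preconnected_fiber (f y) ⟨x, hxy⟩ ⟨y, rfl⟩).map (G.induceHomOfLE hsub).toHom
    have key : ∀ v w : D, (G'.induce D).Reachable v w → ∀ x y : (f ⁻¹' D : Set V),
        f x = v → f y = w → (G.induce (f ⁻¹' D)).Reachable x y := by
      intro v w hvw
      rw [reachable_iff_reflTransGen] at hvw
      induction hvw with
      | refl =>
        intro x y hx hy
        exact fib x y (hx.trans hy.symm)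
      | @tail u w _ huw ih =>
        intro x y hx hy
        obtain ⟨p, q, hp, hq, hpq⟩ := hf.exists_adj_of_adj (show G'.Adj u.1 w.1 from huw)
        let p' : (f ⁻¹' D : Set V) := ⟨p, by show f p ∈ D; rw [hp]; exact u.2⟩
        let q' : (f ⁻¹' D : Set V) := ⟨q, by show f q ∈ D; rw [hq]; exact w.2⟩
        have hadj : (G.induce (f ⁻¹' D)).Adj p' q' := hpq
        exact ((ih x p' hx hp).trans hadj.reachable).trans (fib q' y (hq.trans hy.symm))
    intro x y
    exact key ⟨f x, x.2⟩ ⟨f y, y.2⟩ (h.preconnected _ _) x y rfl rfl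

theorem IsContraction.isConnDominating_of_preimage {D : Set W}
    (h : IsConnDominating G (f ⁻¹' D)) : IsConnDominating G' D := by
  refine ⟨fun w hw => ?_, hf.connected_iff.1 h.2⟩
  obtain ⟨x, rfl⟩ := hf.surjective w
  obtain ⟨y, hy, hxy⟩ := h.1 x hw
  refine ⟨f y, hy, (hf.map_adj hxy).resolve_left fun heq => hw ?_⟩
  rw [heq]
  exact hy

/-- The hypothesis `htb` is what makes domination lift: edges from `t` or `b` to a third vertex may
lift at only some vertices of the fibre, but the edge between `t` and `b` lifts at all of them. -/
theorem IsContraction.isConnDominating_preimage {D : Set W} (h : IsConnDominating G' D)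
    (htb : t ∈ D ∨ b ∈ D) : IsConnDominating G (f ⁻¹' D) := by
  refine ⟨fun x hx => ?_, hf.connected_iff.2 h.2⟩
  have hx' : f x ∉ D := hx
  have : ∃ w ∈ D, G'.Adj (f x) w ∧ ((f x ≠ t ∧ f x ≠ b) ∨ w = t ∨ w = b) := by
    by_cases h1 : f x = t
    · exact ⟨b, htb.resolve_left (h1 ▸ hx'), h1 ▸ hf.adj, Or.inr (Or.inr rfl)⟩
    by_cases h2 : f x = b
    · exact ⟨t, htb.resolve_right (h2 ▸ hx'), h2 ▸ hf.adj.symm, Or.inr (Or.inl rfl)⟩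
    obtain ⟨w, hw, hadj⟩ := h.1 _ hx'
    exact ⟨w, hw, hadj, Or.inl ⟨h1, h2⟩⟩
  obtain ⟨w, hw, hadj, hc⟩ := this
  obtain ⟨y, rfl, hxy⟩ := hf.lift_adj hadj hc
  exact ⟨y, hw, hxy⟩

/-- A coalition partition lifts along a contraction if each coalition contains one of the two
exceptional vertices. -/
theorem IsContraction.defines {U : Type*} [Nonempty U] {H : SimpleGraph U} {c : W → U}
    (hdeg : ∀ v, (G.neighborSet v).encard ≤ 3) (hc : Function.Surjective c)
    (hadj : ∀ i j, H.Adj i j ↔ IsCoalition G' (c ⁻¹' {i}) (c ⁻¹' {j}))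
    (hmeet : ∀ i j, H.Adj i j → (c t = i ∨ c t = j) ∨ c b = i ∨ c b = j)
    (hiso : ∀ i, ∃ j, H.Adj i j) : Defines G H := by
  have hun : ∀ i j, (fun x => c (f x)) ⁻¹' {i} ∪ (fun x => c (f x)) ⁻¹' {j}
      = f ⁻¹' (c ⁻¹' {i} ∪ c ⁻¹' {j}) := fun i j => rfl
  have hcds : ∀ i j, H.Adj i j →
      IsConnDominating G ((fun x => c (f x)) ⁻¹' {i} ∪ (fun x => c (f x)) ⁻¹' {j}) := by
    intro i j hij
    rw [hun]
    exact hf.isConnDominating_preimage ((hadj i j).1 hij).2.2.2 (hmeet i j hij)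
  have hnot : ∀ i, ¬ IsConnDominating G ((fun x => c (f x)) ⁻¹' {i}) := by
    intro i h
    obtain ⟨j, hj⟩ := hiso i
    exact ((hadj i j).1 hj).2.1 (hf.isConnDominating_of_preimage h)
  rw [defines_iff_exists_coloring]
  refine ⟨⟨?_, hdeg⟩, fun x => c (f x), hc.comp hf.surjective, ?_, fun i => Or.inr (hiso i)⟩
  · obtain ⟨i⟩ := ‹Nonempty U›
    obtain ⟨j, hj⟩ := hiso i
    exact (hcds i j hj).connected
  · intro i j
    constructor
    · intro hij
      refine ⟨?_, hnot i, hnot j, hcds i j hij⟩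
      exact (((hadj i j).1 hij).1).preimage f
    · intro h
      rw [hadj]
      refine ⟨?_, ?_, ?_, hf.isConnDominating_of_preimage h.2.2.2⟩
      · exact Disjoint.of_preimage hf.surjective h.1
      -- A connected dominating set of `G'` need not lift, so this does not follow from `h`; it
      -- follows from a coalition of the colour `i` in `G'`.
      · obtain ⟨k, hk⟩ := hiso i
        exact ((hadj i k).1 hk).2.1
      · obtain ⟨k, hk⟩ := hiso j
        exact ((hadj j k).1 hk).2.1

end Contraction

/-! ### A verified test for connected dominating sets -/

section Check

variable {V : Type*}

/-- The members of `rest` not found by a search from `stack`. -/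
def unreached (adj : V → V → Bool) : ℕ → List V → List V → List V
  | 0, _, rest => rest
  | _ + 1, [], rest => rest
  | n + 1, a :: stack, rest =>
    unreached adj n (rest.filter (adj a) ++ stack) (rest.filter fun x => !adj a x)

/-- Checks whether the members of a list form a connected dominating set. -/
def checkConnDominating [DecidableEq V] (adj : V → V → Bool) (univ : List V) : List V → Bool
  | [] => false
  | a :: l => (unreached adj (l.length + 1) [a] l).isEmpty &&
      univ.all fun v => (a :: l).any fun u => decide (v = u) || adj v u

theorem mem_of_mem_unreached {adj : V → V → Bool} {n : ℕ} {stack rest : List V} {x : V}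
    (h : x ∈ unreached adj n stack rest) : x ∈ rest := by
  induction n generalizing stack rest with
  | zero => simpa [unreached] using h
  | succ n ih =>
    cases stack with
    | nil => simpa [unreached] using h
    | cons a stack => exact List.mem_of_mem_filter (ih h)

/-- Each step pops one vertex and at most moves others from `rest` to the stack, so the total length
drops by one. With this much fuel the search ends with an empty stack, and every vertex it met has
had its neighbours removed from `rest`. -/
theorem adj_eq_false_of_mem_unreached {adj : V → V → Bool} {n : ℕ} {stack rest : List V}
    (hn : stack.length + rest.length ≤ n) {x y : V} (hx : x ∈ stack ∨ x ∈ rest)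
    (hxu : x ∉ unreached adj n stack rest) (hy : y ∈ unreached adj n stack rest) :
    adj x y = false := by
  induction n generalizing stack rest with
  | zero =>
    have := mem_of_mem_unreached hy
    have : 0 < rest.length := List.length_pos_of_mem this
    omega
  | succ n ih =>
    cases stack with
    | nil =>
      simp only [unreached] at hxu
      simp_all
    | cons a stack =>
      simp only [unreached] at hxu hy
      have hlen : (rest.filter (adj a)).length + (rest.filter fun x => !adj a x).length
          = rest.length := (List.length_eq_length_filter_add (adj a)).symm
      by_cases hxa : x = a
      · subst hxa
        simpa using List.of_mem_filter (mem_of_mem_unreached hy)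
      · refine ih ?_ ?_ hxu hy
        · simp only [List.length_append, List.length_cons] at hn ⊢
          omega
        · simp only [List.mem_cons, List.mem_append, List.mem_filter] at hx ⊢
          cases hax : adj a x <;> simp_all [or_comm]

variable {G : SimpleGraph V} {adj : V → V → Bool} (hG : ∀ x y, adj x y = true ↔ G.Adj x y)
include hG

theorem reachable_of_notMem_unreached {D : Set V} {r : D} {n : ℕ} {stack rest : List V}
    (hstack : ∀ a ∈ stack, ∃ h : a ∈ D, (G.induce D).Reachable r ⟨a, h⟩)
    (hrest : ∀ x ∈ rest, x ∈ D) {x : V} (hx : x ∈ rest) (hxu : x ∉ unreached adj n stack rest) :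
    ∃ h : x ∈ D, (G.induce D).Reachable r ⟨x, h⟩ := by
  induction n generalizing stack rest with
  | zero => exact absurd hx hxu
  | succ n ih =>
    cases stack with
    | nil => exact absurd hx hxu
    | cons a stack =>
      obtain ⟨ha, hra⟩ := hstack a (by simp)
      have hstep : ∀ y ∈ rest, adj a y = true →
          ∃ h : y ∈ D, (G.induce D).Reachable r ⟨y, h⟩ := by
        intro y hy hay
        exact ⟨hrest y hy, hra.trans
          (Adj.reachable (show (G.induce D).Adj ⟨a, ha⟩ ⟨y, hrest y hy⟩ from (hG a y).1 hay))⟩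
      by_cases hax : adj a x = true
      · exact hstep x hx hax
      · refine ih ?_ ?_ ?_ hxu
        · intro y hy
          simp only [List.mem_append, List.mem_filter] at hy
          rcases hy with ⟨hy, hay⟩ | hy
          · exact hstep y hy hay
          · exact hstack y (by simp [hy])
        · exact fun y hy => hrest y (List.mem_of_mem_filter hy)
        · simp [List.mem_filter, hx, hax]

theorem checkConnDominating_iff [DecidableEq V] {univ l : List V} {D : Set V}
    (huniv : ∀ v, v ∈ univ) (hnd : l.Nodup) (hD : ∀ v, v ∈ l ↔ v ∈ D) :
    checkConnDominating adj univ l = true ↔ IsConnDominating G D := by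
  cases l with
  | nil =>
    simp only [checkConnDominating, Bool.false_eq_true, false_iff]
    intro h
    obtain ⟨⟨r, hr⟩⟩ := h.2.nonempty
    simpa using (hD r).2 hr
  | cons a l =>
    have ha : a ∈ D := (hD a).1 (by simp)
    have hal : a ∉ l := (List.nodup_cons.1 hnd).1
    have hdom : (univ.all fun v => (a :: l).any fun u => decide (v = u) || adj v u) = true ↔
        ∀ v, v ∉ D → ∃ u ∈ D, G.Adj v u := by
      rw [List.all_eq_true]
      constructor
      · intro h v hv
        obtain ⟨u, hu, huv⟩ := List.any_eq_true.1 (h v (huniv v))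
        have huD := (hD u).1 hu
        rcases Bool.or_eq_true_iff.1 huv with heq | hadj
        · exact absurd (of_decide_eq_true heq ▸ huD) hv
        · exact ⟨u, huD, (hG v u).1 hadj⟩
      · intro h v _
        rw [List.any_eq_true]
        by_cases hv : v ∈ D
        · exact ⟨v, (hD v).2 hv, by simp⟩
        · obtain ⟨u, hu, huv⟩ := h v hv
          exact ⟨u, (hD u).2 hu, by simp [(hG v u).2 huv]⟩
    have hconn : (unreached adj (l.length + 1) [a] l).isEmpty = true ↔
        (G.induce D).Connected := by
      rw [List.isEmpty_iff]
      constructor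
      · intro h
        have hr : ∀ x : D, (G.induce D).Reachable ⟨a, ha⟩ x := by
          rintro ⟨x, hx⟩
          rcases List.mem_cons.1 ((hD x).2 hx) with rfl | hxl
          · exact Reachable.refl _
          · obtain ⟨_, hreach⟩ := reachable_of_notMem_unreached hG (D := D) (r := ⟨a, ha⟩)
              (n := l.length + 1) (stack := [a]) (rest := l)
              (by
                intro y hy
                obtain rfl : y = a := by simpa using hy
                exact ⟨ha, Reachable.refl _⟩)
              (fun y hy => (hD y).1 (by simp [hy])) hxl (by rw [h]; simp)
            exact hreach
        have : Nonempty D := ⟨⟨a, ha⟩⟩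
        exact ⟨fun x y => (hr x).symm.trans (hr y)⟩
      · intro h
        by_contra hne
        obtain ⟨y, hy⟩ := List.exists_mem_of_ne_nil _ hne
        have hyD : y ∈ D := (hD y).1 (by simp [mem_of_mem_unreached hy])
        -- A path from `a` to an unreached vertex would contain an edge from a reached vertex to an
        -- unreached one.
        obtain ⟨p⟩ := h.preconnected ⟨a, ha⟩ ⟨y, hyD⟩
        obtain ⟨d, -, hd1, hd2⟩ := p.exists_boundary_dart
          {x | x.1 ∉ unreached adj (l.length + 1) [a] l}
          (fun hmem => hal (mem_of_mem_unreached hmem)) (by simpa using hy)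
        have hd2' : d.toProd.2.1 ∈ unreached adj (l.length + 1) [a] l := by simpa using hd2
        have hx := adj_eq_false_of_mem_unreached (by simp [Nat.add_comm])
          (List.mem_cons.1 ((hD d.toProd.1.1).2 d.toProd.1.2) |>.imp
            (fun h => by simp [h]) id) hd1 hd2'
        have := (hG _ _).2 (show G.Adj d.toProd.1.1 d.toProd.2.1 from d.adj)
        simp [hx] at this
    rw [checkConnDominating, Bool.and_eq_true, hconn, hdom]
    exact and_comm

theorem isCoalition_fiber_iff_check [DecidableEq V] {U : Type*} [DecidableEq U] {c : V → U}
    (hc : Function.Surjective c) {univ : List V} (huniv : ∀ v, v ∈ univ) (hnd : univ.Nodup)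
    (i j : U) :
    IsCoalition G (c ⁻¹' {i}) (c ⁻¹' {j}) ↔ i ≠ j ∧
      checkConnDominating adj univ (univ.filter fun v => c v = i) = false ∧
      checkConnDominating adj univ (univ.filter fun v => c v = j) = false ∧
      checkConnDominating adj univ (univ.filter fun v => c v = i ∨ c v = j) = true := by
  have h1 : ∀ k, checkConnDominating adj univ (univ.filter fun v => c v = k) = true ↔
      IsConnDominating G (c ⁻¹' {k}) := fun k =>
    checkConnDominating_iff hG huniv (hnd.filter _) (by simp [huniv])
  have h2 : checkConnDominating adj univ (univ.filter fun v => c v = i ∨ c v = j) = true ↔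
      IsConnDominating G (c ⁻¹' {i} ∪ c ⁻¹' {j}) :=
    checkConnDominating_iff hG huniv (hnd.filter _) (by simp [huniv])
  have h3 : Disjoint (c ⁻¹' {i}) (c ⁻¹' {j}) ↔ i ≠ j := by
    constructor
    · rintro h rfl
      obtain ⟨v, hv⟩ := hc i
      exact Set.disjoint_left.1 h hv hv
    · intro h
      exact Set.disjoint_left.2 fun v hv hv' => h (Eq.trans (Eq.symm hv) hv')
  rw [IsCoalition, h3, ← h1, ← h1, ← h2, Bool.not_eq_true, Bool.not_eq_true]

end Check

/-! ### Möbius ladders, their modification, and the contraction to order ten -/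

section Ladder

theorem encard_triple_le {α : Type*} (a b c : α) : ({a, b, c} : Set α).encard ≤ 3 := by
  have h := (Set.encard_insert_le {b, c} a).trans
    (add_le_add_left ((Set.encard_insert_le {c} b).trans_eq
      (congrArg (· + 1) (Set.encard_singleton c))) 1)
  exact h.trans (by norm_num)

theorem encard_neighborSet_le_three {n : ℕ} {G : SimpleGraph (Fin n)} {x : Fin n} (p q r : ℕ)
    (h : ∀ y, G.Adj x y → y.val = p ∨ y.val = q ∨ y.val = r) :
    (G.neighborSet x).encard ≤ 3 := by
  rw [← Fin.val_injective.encard_image]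
  refine (Set.encard_le_encard (t := {p, q, r}) ?_).trans (encard_triple_le p q r)
  rintro _ ⟨y, hy, rfl⟩
  simpa using h y hy

/-- Adjacency in the Möbius ladder of order `2 * s + 10`, in terms of representatives. -/
abbrev LadderAdj (s x y : ℕ) : Prop :=
  (x + 1 = y ∨ x = 0 ∧ y = 2 * s + 9 ∨ x + (s + 5) = y) ∨
    (y + 1 = x ∨ y = 0 ∧ x = 2 * s + 9 ∨ y + (s + 5) = x)

/-- The edges of the Möbius ladder of order `2 * s + 10` that are removed in `modLadder`. -/
abbrev RemovedAdj (s x y : ℕ) : Prop :=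
  (x = s + 1 ∧ y = s + 2 ∨ x = s + 3 ∧ y = 2 * s + 8) ∨
    (y = s + 1 ∧ x = s + 2 ∨ y = s + 3 ∧ x = 2 * s + 8)

/-- The edges that are added to the Möbius ladder of order `2 * s + 10` in `modLadder`. -/
abbrev AddedAdj (s x y : ℕ) : Prop :=
  (x = s + 1 ∧ y = s + 3 ∨ x = s + 2 ∧ y = 2 * s + 8) ∨
    (y = s + 1 ∧ x = s + 3 ∨ y = s + 2 ∧ x = 2 * s + 8)

/-- The Möbius ladder of order `2 * s + 10`. -/
def ladder (s : ℕ) : SimpleGraph (Fin (2 * s + 10)) where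
  Adj x y := LadderAdj s x y
  symm := ⟨fun _ _ h => h.symm⟩
  loopless := ⟨fun x h => by omega⟩

/-- The Möbius ladder of order `2 * s + 10` with two edges replaced by two others. -/
def modLadder (s : ℕ) : SimpleGraph (Fin (2 * s + 10)) where
  Adj x y := LadderAdj s x y ∧ ¬ RemovedAdj s x y ∨ AddedAdj s x y
  symm := ⟨fun _ _ h => h.imp (fun h => ⟨h.1.symm, fun h' => h.2 h'.symm⟩) Or.symm⟩
  loopless := ⟨fun x h => by omega⟩

instance (s : ℕ) : DecidableRel (ladder s).Adj := fun x y =>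
  inferInstanceAs (Decidable (LadderAdj s x y))

instance (s : ℕ) : DecidableRel (modLadder s).Adj := fun x y =>
  inferInstanceAs (Decidable (LadderAdj s x y ∧ ¬ RemovedAdj s x y ∨ AddedAdj s x y))

theorem ladder_adj {s : ℕ} {x y : Fin (2 * s + 10)} :
    (ladder s).Adj x y ↔ LadderAdj s x y := Iff.rfl

theorem modLadder_adj {s : ℕ} {x y : Fin (2 * s + 10)} :
    (modLadder s).Adj x y ↔ LadderAdj s x y ∧ ¬ RemovedAdj s x y ∨ AddedAdj s x y := Iff.rfl

/-- Replaces arithmetic modulo the order by linear arithmetic of representatives, which `omega`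
decides. `ZMod (2 * s + 10)` and `Fin (2 * s + 10)` agree by definition. -/
theorem mobiusLadder_eq_ladder (s : ℕ) : mobiusLadder (2 * s + 10) = ladder s := by
  have hsub : ∀ (x y : ZMod (2 * s + 10)) (k : ℕ), k < 2 * s + 10 →
      (x - y = (k : ZMod (2 * s + 10)) ↔
        x.val = y.val + k ∨ x.val + (2 * s + 10) = y.val + k) := by
    intro x y k hk
    rw [sub_eq_iff_eq_add, ← (ZMod.val_injective (2 * s + 10)).eq_iff, ZMod.val_add,
      ZMod.val_natCast, Nat.mod_eq_of_lt hk]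
    have hx := ZMod.val_lt x
    have hy := ZMod.val_lt y
    rcases lt_or_ge (k + y.val) (2 * s + 10) with h | h
    · rw [Nat.mod_eq_of_lt h]
      omega
    · rw [Nat.mod_eq_sub_mod h, Nat.mod_eq_of_lt (by omega)]
      omega
  have h1 := fun x y => hsub x y 1 (by omega)
  have hh := fun x y => hsub x y (s + 5) (by omega)
  ext x y
  have hx := ZMod.val_lt x
  have hy := ZMod.val_lt y
  have hxy : x ≠ y ↔ x.val ≠ y.val := (ZMod.val_injective (2 * s + 10)).ne_iff.symm
  have hlad : (ladder s).Adj x y ↔ LadderAdj s x.val y.val := Iff.rfl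
  rw [hlad]
  simp only [mobiusLadder, circulantGraph, fromRel_adj, Set.mem_insert_iff,
    Set.mem_singleton_iff]
  rw [show (2 * s + 10) / 2 = s + 5 by omega, hxy, hh, hh]
  simp only [Nat.cast_one] at h1
  rw [h1, h1]
  omega

/-- The contraction of a ladder of order `2 * s + 10` to one of order `10`. -/
def contractLadder (s : ℕ) (x : Fin (2 * s + 10)) : Fin 10 :=
  ⟨if x.val < s + 5 then x.val - s else 5 + (x.val - (s + 5) - s), by split_ifs <;> omega⟩

/-- The fibres are intervals: the first `s + 1` vertices of the two rails over `0` and `5`, and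
single vertices elsewhere. -/
theorem contractLadder_eq_iff {s : ℕ} {x : Fin (2 * s + 10)} {w : Fin 10} :
    contractLadder s x = w ↔
      (if w.val = 0 then 0 else if w.val ≤ 5 then s + w.val else 2 * s + w.val) ≤ x.val ∧
        x.val ≤ if w.val < 5 then s + w.val else 2 * s + w.val := by
  rw [Fin.ext_iff, contractLadder]
  dsimp only
  split_ifs <;> omega

theorem contractLadder_val_eq_one {s : ℕ} {x : Fin (2 * s + 10)} :
    (contractLadder s x).val = 1 ↔ x.val = s + 1 := by
  dsimp only [contractLadder]
  split_ifs <;> omega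

theorem contractLadder_val_eq_two {s : ℕ} {x : Fin (2 * s + 10)} :
    (contractLadder s x).val = 2 ↔ x.val = s + 2 := by
  dsimp only [contractLadder]
  split_ifs <;> omega

theorem contractLadder_val_eq_three {s : ℕ} {x : Fin (2 * s + 10)} :
    (contractLadder s x).val = 3 ↔ x.val = s + 3 := by
  dsimp only [contractLadder]
  split_ifs <;> omega

theorem contractLadder_val_eq_eight {s : ℕ} {x : Fin (2 * s + 10)} :
    (contractLadder s x).val = 8 ↔ x.val = 2 * s + 8 := by
  dsimp only [contractLadder]
  split_ifs <;> omega

theorem preconnected_fiber_contractLadder {s : ℕ} {G : SimpleGraph (Fin (2 * s + 10))}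
    (hG : ∀ x y, x.val + 1 = y.val → y.val ≤ s ∨ s + 5 ≤ x.val ∧ y.val ≤ 2 * s + 5 → G.Adj x y)
    (w : Fin 10) : (G.induce (contractLadder s ⁻¹' {w})).Preconnected := by
  have : contractLadder s ⁻¹' {w} = {x |
      (if w.val = 0 then 0 else if w.val ≤ 5 then s + w.val else 2 * s + w.val) ≤ x.val ∧
        x.val ≤ if w.val < 5 then s + w.val else 2 * s + w.val} := by
    ext x
    exact contractLadder_eq_iff
  rw [this]
  refine preconnected_induce_Icc fun x y hxy h1 h2 => hG x y hxy ?_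
  split_ifs at h1 h2 <;> omega

theorem contractLadder_surjective (s : ℕ) : Function.Surjective (contractLadder s) := by
  intro w
  refine ⟨⟨if w.val < 5 then s + w.val else 2 * s + w.val, by split_ifs <;> omega⟩, ?_⟩
  rw [contractLadder_eq_iff]
  dsimp only
  split_ifs <;> omega

/-- The end in the fibre of `w` of the edge that lifts the edge from `u` to `w` at `x`. -/
def liftLadder (s x u w : ℕ) : ℕ :=
  if w = 0 then (if u = 5 then x - (s + 5) else if u = 1 then s else 0)
  else if w = 5 then (if u = 0 then x + (s + 5) else if u = 6 then 2 * s + 5 else s + 5)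
  else if w < 5 then s + w else 2 * s + w

/-- The exceptional pair is `0`, `5`: an edge that leaves a contracted segment along its rail exists
only at an end of the segment, whereas each vertex of the segment has its rung. -/
theorem ladder_isContraction (s : ℕ) :
    IsContraction (ladder s) (ladder 0) (contractLadder s) 0 5 where
  surjective := contractLadder_surjective s
  preconnected_fiber := preconnected_fiber_contractLadder fun x y h _ => Or.inl (Or.inl h)
  map_adj := by
    intro x y h
    rw [ladder_adj] at h ⊢
    rw [Fin.ext_iff, contractLadder, contractLadder]
    dsimp only
    split_ifs <;> omega
  adj := by decide
  lift_adj := by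
    intro x w h hc
    rw [ladder_adj] at h
    simp only [ne_eq, Fin.ext_iff] at hc
    have hu := contractLadder_eq_iff.1 (rfl : contractLadder s x = contractLadder s x)
    have hlt := (contractLadder s x).isLt
    generalize (contractLadder s x).val = u at h hc hu hlt
    have hv0 : ((0 : Fin 10) : ℕ) = 0 := rfl
    have hv5 : ((5 : Fin 10) : ℕ) = 5 := rfl
    rw [hv0, hv5] at hc
    refine ⟨⟨liftLadder s x u w, ?_⟩, ?_, ?_⟩
    · unfold liftLadder
      split_ifs at hu ⊢ <;> omega
    · rw [contractLadder_eq_iff]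
      dsimp only [liftLadder]
      split_ifs at hu ⊢ <;> omega
    · rw [ladder_adj]
      dsimp only [liftLadder]
      split_ifs at hu ⊢ <;> omega

theorem removedAdj_contractLadder {s : ℕ} {x y : Fin (2 * s + 10)} :
    RemovedAdj 0 (contractLadder s x) (contractLadder s y) ↔ RemovedAdj s x y := by
  simp only [RemovedAdj, contractLadder_val_eq_one, contractLadder_val_eq_two,
    contractLadder_val_eq_three, contractLadder_val_eq_eight, Nat.zero_add, Nat.mul_zero]

theorem addedAdj_contractLadder {s : ℕ} {x y : Fin (2 * s + 10)} :
    AddedAdj 0 (contractLadder s x) (contractLadder s y) ↔ AddedAdj s x y := by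
  simp only [AddedAdj, contractLadder_val_eq_one, contractLadder_val_eq_two,
    contractLadder_val_eq_three, contractLadder_val_eq_eight, Nat.zero_add, Nat.mul_zero]

/-- The ends of the swapped edges lie over `1`, `2`, `3` and `8`, whose fibres are single vertices.
So the swap commutes with the contraction and leaves the contracted segments and their rungs intact.
-/
theorem modLadder_isContraction (s : ℕ) :
    IsContraction (modLadder s) (modLadder 0) (contractLadder s) 0 5 where
  surjective := contractLadder_surjective s
  preconnected_fiber := by
    refine preconnected_fiber_contractLadder fun x y h h' => Or.inl ⟨Or.inl (Or.inl h), ?_⟩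
    rintro (h | h) <;> omega
  map_adj := by
    intro x y h
    rw [modLadder_adj] at h ⊢
    rw [removedAdj_contractLadder, addedAdj_contractLadder]
    rcases h with ⟨h, hr⟩ | h
    · exact ((ladder_isContraction s).map_adj h).imp id fun h => Or.inl ⟨h, hr⟩
    · exact Or.inr (Or.inr h)
  adj := by decide
  lift_adj := by
    intro x w h hc
    rw [modLadder_adj] at h
    rcases h with ⟨h, hr⟩ | h
    · obtain ⟨y, rfl, hy⟩ := (ladder_isContraction s).lift_adj h hc
      exact ⟨y, rfl, Or.inl ⟨hy, fun h' => hr (removedAdj_contractLadder.2 h')⟩⟩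
    · obtain ⟨y, rfl⟩ := contractLadder_surjective s w
      exact ⟨y, rfl, Or.inr (addedAdj_contractLadder.1 h)⟩

theorem encard_neighborSet_ladder_le (s : ℕ) (x : Fin (2 * s + 10)) :
    ((ladder s).neighborSet x).encard ≤ 3 := by
  refine encard_neighborSet_le_three (if x.val = 2 * s + 9 then 0 else x + 1)
    (if x.val = 0 then 2 * s + 9 else x - 1)
    (if x.val < s + 5 then x + (s + 5) else x - (s + 5)) fun y h => ?_
  rw [ladder_adj] at h
  split_ifs <;> omega

theorem encard_neighborSet_modLadder_le (s : ℕ) (x : Fin (2 * s + 10)) :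
    ((modLadder s).neighborSet x).encard ≤ 3 := by
  refine encard_neighborSet_le_three
    (if x.val = s + 1 then s + 3 else if x.val = 2 * s + 9 then 0 else x + 1)
    (if x.val = s + 2 then 2 * s + 8 else if x.val = 0 then 2 * s + 9 else x - 1)
    (if x.val = s + 3 then s + 1 else if x.val = 2 * s + 8 then s + 2 else
      if x.val < s + 5 then x + (s + 5) else x - (s + 5)) fun y h => ?_
  rw [modLadder_adj] at h
  split_ifs <;> omega

theorem encard_symmDiff_modLadder_le (s : ℕ) :
    (symmDiff (modLadder s).edgeSet (ladder s).edgeSet).encard ≤ 4 := by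
  let v : ∀ k, k < 2 * s + 10 → Fin (2 * s + 10) := fun k hk => ⟨k, hk⟩
  have hle : ({s(v (s + 1) (by omega), v (s + 2) (by omega)),
      s(v (s + 3) (by omega), v (2 * s + 8) (by omega)),
      s(v (s + 1) (by omega), v (s + 3) (by omega)),
      s(v (s + 2) (by omega), v (2 * s + 8) (by omega))} :
      Set (Sym2 (Fin (2 * s + 10)))).encard ≤ 4 :=
    ((Set.encard_insert_le _ _).trans (add_le_add_left (encard_triple_le _ _ _) 1)).trans
      (by norm_num)
  refine (Set.encard_le_encard ?_).trans hle
  intro e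
  induction e using Sym2.ind with
  | _ x y =>
    intro h
    rw [Set.mem_symmDiff, mem_edgeSet, mem_edgeSet, modLadder_adj, ladder_adj] at h
    have h' : RemovedAdj s x y ∨ AddedAdj s x y := by
      rcases h with ⟨h | h, hn⟩ | ⟨h, hn⟩
      · exact absurd h.1 hn
      · exact Or.inr h
      · exact Or.inl (not_not.1 fun hr => hn (Or.inl ⟨h, hr⟩))
    clear h
    have aux : ∀ (k l : ℕ) (hk : k < 2 * s + 10) (hl : l < 2 * s + 10),
        (x.val = k ∧ y.val = l) ∨ (y.val = k ∧ x.val = l) → s(x, y) = s(v k hk, v l hl) := by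
      rintro k l hk hl (⟨h1, h2⟩ | ⟨h1, h2⟩)
      · rw [show x = v k hk from Fin.ext h1, show y = v l hl from Fin.ext h2]
      · rw [show y = v k hk from Fin.ext h1, show x = v l hl from Fin.ext h2, Sym2.eq_swap]
    rcases h' with (h | h) | h | h <;> rcases h with h | h
    · exact Or.inl (aux _ _ _ _ (Or.inl h))
    · exact Or.inr (Or.inl (aux _ _ _ _ (Or.inl h)))
    · exact Or.inl (aux _ _ _ _ (Or.inr h))
    · exact Or.inr (Or.inl (aux _ _ _ _ (Or.inr h)))
    · exact Or.inr (Or.inr (Or.inl (aux _ _ _ _ (Or.inl h))))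
    · exact Or.inr (Or.inr (Or.inr (aux _ _ _ _ (Or.inl h))))
    · exact Or.inr (Or.inr (Or.inl (aux _ _ _ _ (Or.inr h))))
    · exact Or.inr (Or.inr (Or.inr (aux _ _ _ _ (Or.inr h))))

end Ladder

/-! ### Colourings verified by computation -/

section Certificates

/-- The adjacencies of the coalition graph of a colouring of a finite graph, computed. -/
abbrev IsColoringFor {n : ℕ} {U : Type*} [DecidableEq U] (G : SimpleGraph (Fin n))
    [DecidableRel G.Adj] (H : SimpleGraph U) (c : Fin n → U) : Prop :=
  (∀ u, ∃ v, c v = u) ∧ (∀ i, ∃ j, H.Adj i j) ∧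
    ∀ i j, H.Adj i j ↔ i ≠ j ∧
      checkConnDominating (fun x y => decide (G.Adj x y)) (List.finRange n)
        ((List.finRange n).filter fun v => c v = i) = false ∧
      checkConnDominating (fun x y => decide (G.Adj x y)) (List.finRange n)
        ((List.finRange n).filter fun v => c v = j) = false ∧
      checkConnDominating (fun x y => decide (G.Adj x y)) (List.finRange n)
        ((List.finRange n).filter fun v => c v = i ∨ c v = j) = true

variable {U : Type*} [DecidableEq U] {H : SimpleGraph U}

theorem IsColoringFor.adj_iff {n : ℕ} {G : SimpleGraph (Fin n)} [DecidableRel G.Adj]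
    {c : Fin n → U} (h : IsColoringFor G H c) (i j : U) :
    H.Adj i j ↔ IsCoalition G (c ⁻¹' {i}) (c ⁻¹' {j}) := by
  rw [h.2.2 i j, isCoalition_fiber_iff_check (G := G) (univ := List.finRange n)
    (fun _ _ => decide_eq_true_iff) h.1 List.mem_finRange (List.nodup_finRange n)]

variable [Nonempty U]

theorem IsColoringFor.defines {n : ℕ} {G : SimpleGraph (Fin n)} [DecidableRel G.Adj]
    {c : Fin n → U} (h : IsColoringFor G H c) (hdeg : ∀ v, (G.neighborSet v).encard ≤ 3) :
    Defines G H := by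
  rw [defines_iff_exists_coloring]
  obtain ⟨i⟩ := ‹Nonempty U›
  obtain ⟨j, hj⟩ := h.2.1 i
  exact ⟨⟨((h.adj_iff i j).1 hj).2.2.2.connected, hdeg⟩, c, h.1, h.adj_iff,
    fun i => Or.inr (h.2.1 i)⟩

/-- The condition `hmeet` says that the colours of `0` and `5` form a vertex cover of `H`, so that
each coalition meets the exceptional pair. -/
theorem IsColoringFor.defines_ladder {c : Fin 10 → U} (h : IsColoringFor (ladder 0) H c)
    (hmeet : ∀ i j, H.Adj i j → (c 0 = i ∨ c 0 = j) ∨ c 5 = i ∨ c 5 = j) (s : ℕ) :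
    Defines (ladder s) H :=
  (ladder_isContraction s).defines (encard_neighborSet_ladder_le s) h.1 h.adj_iff hmeet h.2.1

theorem IsColoringFor.defines_modLadder {c : Fin 10 → U} (h : IsColoringFor (modLadder 0) H c)
    (hmeet : ∀ i j, H.Adj i j → (c 0 = i ∨ c 0 = j) ∨ c 5 = i ∨ c 5 = j) (s : ℕ) :
    Defines (modLadder s) H :=
  (modLadder_isContraction s).defines (encard_neighborSet_modLadder_le s) h.1 h.adj_iff hmeet
    h.2.1

end Certificates

/-! ### Graphs defined by infinitely many ladders -/

section MobiusLadders

theorem encard_neighborSet_le_of_card_filter {n : ℕ} {G : SimpleGraph (Fin n)}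
    [DecidableRel G.Adj] (h : ∀ v, (Finset.univ.filter fun w => G.Adj v w).card ≤ 3) (v : Fin n) :
    (G.neighborSet v).encard ≤ 3 := by
  have : G.neighborSet v = (Finset.univ.filter fun w => G.Adj v w : Finset (Fin n)) := by
    ext w
    simp
  rw [this, Set.encard_coe_eq_coe_finsetCard]
  exact_mod_cast h v

/-- The order of a graph is an isomorphism invariant, and it is unbounded on `S`. -/
theorem infinite_of_forall_exists {S : Set GraphClass}
    (h : ∀ N : ℕ, ∃ n, N ≤ n ∧ ∃ G : SimpleGraph (Fin n), graphClass G ∈ S) : S.Infinite := by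
  have hcard : ∀ a b : Σ n : ℕ, SimpleGraph (Fin n), graphSetoid a b → a.1 = b.1 := by
    rintro ⟨n, G⟩ ⟨m, G'⟩ ⟨e⟩
    simpa using Fintype.card_congr e.toEquiv
  let order : GraphClass → ℕ := Quotient.lift (fun a => a.1) hcard
  intro hS
  obtain ⟨N, hN⟩ := (hS.image order).bddAbove
  obtain ⟨n, hn, G, hG⟩ := h (N + 1)
  have : n ≤ N := hN ⟨_, hG, rfl⟩
  omega

variable {U : Type} [DecidableEq U] [Nonempty U] {H : SimpleGraph U}

theorem IsColoringFor.definedByMobiusLadders {c : Fin 10 → U} (h : IsColoringFor (ladder 0) H c)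
    (hmeet : ∀ i j, H.Adj i j → (c 0 = i ∨ c 0 = j) ∨ c 5 = i ∨ c 5 = j) :
    DefinedByMobiusLadders H := by
  refine ⟨infinite_of_forall_exists fun N => ⟨2 * N + 10, by omega, ladder N, _, _, rfl,
    h.defines_ladder hmeet N⟩, ?_⟩
  rintro n hn ⟨m, rfl⟩
  obtain ⟨s, rfl⟩ : ∃ s, m = s + 5 := ⟨m - 5, by omega⟩
  rw [show s + 5 + (s + 5) = 2 * s + 10 by omega, mobiusLadder_eq_ladder]
  exact h.defines_ladder hmeet s

theorem IsColoringFor.definedByModifiedMobiusLadders {c : Fin 10 → U}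
    (h : IsColoringFor (modLadder 0) H c)
    (hmeet : ∀ i j, H.Adj i j → (c 0 = i ∨ c 0 = j) ∨ c 5 = i ∨ c 5 = j) :
    DefinedByModifiedMobiusLadders H := by
  refine ⟨infinite_of_forall_exists fun N => ⟨2 * N + 10, by omega, modLadder N, _, _, rfl,
    h.defines_modLadder hmeet N⟩, 4, ?_⟩
  rintro n hn ⟨m, rfl⟩
  obtain ⟨s, rfl⟩ : ∃ s, m = s + 5 := ⟨m - 5, by omega⟩
  rw [show s + 5 + (s + 5) = 2 * s + 10 by omega, mobiusLadder_eq_ladder]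
  exact ⟨modLadder s, encard_symmDiff_modLadder_le s, h.defines_modLadder hmeet s⟩

instance decidableRelPathGraphAdj (n : ℕ) : DecidableRel (pathGraph n).Adj := fun _ _ =>
  decidable_of_iff' _ pathGraph_adj

instance decidableRelSumAdj {α β : Type*} (G : SimpleGraph α) (G' : SimpleGraph β)
    [DecidableRel G.Adj] [DecidableRel G'.Adj] : DecidableRel (G ⊕g G').Adj
  | .inl a, .inl b => decidable_of_iff (G.Adj a b) (by simp)
  | .inr a, .inr b => decidable_of_iff (G'.Adj a b) (by simp)
  | .inl _, .inr _ => isFalse (by simp)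
  | .inr _, .inl _ => isFalse (by simp)

instance decidableRelCompleteBipartiteGraphAdj (α β : Type*) :
    DecidableRel (completeBipartiteGraph α β).Adj := fun a b =>
  inferInstanceAs (Decidable (a.isLeft ∧ b.isRight ∨ a.isRight ∧ b.isLeft))

/-- In this and the following certificates, the first five entries colour one rail and the last five
the other; entries `0` and `5` are the colours of the two segments that grow with `s`. -/
theorem definedByMobiusLadders_cycleGraph_three : DefinedByMobiusLadders (cycleGraph 3) :=
  IsColoringFor.definedByMobiusLadders
    (c := ![0, 0, 0, 1, 0, 1, 1, 1, 2, 2]) (by decide +kernel) (by decide +kernel)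

theorem definedByMobiusLadders_twoK2 : DefinedByMobiusLadders twoK2 :=
  IsColoringFor.definedByMobiusLadders
    (c := ![0, 0, 0, 1, 0, 2, 2, 3, 2, 1]) (by decide +kernel) (by decide +kernel)

theorem definedByMobiusLadders_pathGraph_four : DefinedByMobiusLadders (pathGraph 4) :=
  IsColoringFor.definedByMobiusLadders
    (c := ![2, 2, 2, 1, 2, 1, 1, 1, 0, 3]) (by decide +kernel) (by decide +kernel)

theorem definedByMobiusLadders_cycleGraph_four : DefinedByMobiusLadders (cycleGraph 4) :=
  IsColoringFor.definedByMobiusLadders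
    (c := ![0, 0, 0, 1, 1, 2, 2, 3, 2, 3]) (by decide +kernel) (by decide +kernel)

theorem definedByMobiusLadders_C3e : DefinedByMobiusLadders C3e :=
  IsColoringFor.definedByMobiusLadders
    (c := ![0, 0, 0, 1, 0, 2, 1, 2, 1, 3]) (by decide +kernel) (by decide +kernel)

theorem definedByMobiusLadders_K4MinusE : DefinedByMobiusLadders K4MinusE :=
  IsColoringFor.definedByMobiusLadders
    (c := ![2, 2, 2, 0, 0, 3, 3, 3, 1, 1]) (by decide +kernel) (by decide +kernel)

theorem definedByMobiusLadders_P2UnionP3 : DefinedByMobiusLadders P2UnionP3 :=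
  IsColoringFor.definedByMobiusLadders
    (c := ![.inr 1, .inr 1, .inr 1, .inr 0, .inr 1, .inl 0, .inl 0, .inl 1, .inl 0, .inr 2])
    (by decide +kernel) (by decide +kernel)

theorem definedByMobiusLadders_S12 : DefinedByMobiusLadders S12 :=
  IsColoringFor.definedByMobiusLadders
    (c := ![1, 1, 1, 3, 1, 0, 0, 0, 2, 4]) (by decide +kernel) (by decide +kernel)

theorem definedByMobiusLadders_pathGraph_five : DefinedByMobiusLadders (pathGraph 5) :=
  IsColoringFor.definedByMobiusLadders
    (c := ![3, 3, 3, 2, 2, 1, 1, 0, 1, 4]) (by decide +kernel) (by decide +kernel)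

theorem definedByMobiusLadders_C3ee : DefinedByMobiusLadders C3ee :=
  IsColoringFor.definedByMobiusLadders
    (c := ![0, 0, 0, 2, 2, 1, 1, 1, 4, 3]) (by decide +kernel) (by decide +kernel)

theorem definedByMobiusLadders_C32e : DefinedByMobiusLadders C32e :=
  IsColoringFor.definedByMobiusLadders
    (c := ![0, 0, 3, 0, 1, 1, 2, 2, 0, 4]) (by decide +kernel) (by decide +kernel)

theorem definedByMobiusLadders_S22 : DefinedByMobiusLadders S22 :=
  IsColoringFor.definedByMobiusLadders
    (c := ![0, 0, 0, 2, 4, 1, 1, 1, 5, 3]) (by decide +kernel) (by decide +kernel)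

theorem definedByModifiedMobiusLadders_C4e : DefinedByModifiedMobiusLadders C4e :=
  IsColoringFor.definedByModifiedMobiusLadders
    (c := ![2, 2, 1, 1, 0, 0, 0, 4, 3, 3]) (by decide +kernel) (by decide +kernel)

end MobiusLadders
-- Examples for the finitely defined graphs with edges
section SmallGraphs

/-- The circulant graph is the Möbius ladder of order `8`. -/
theorem definingClasses_completeGraph_four_nonempty :
    (definingClasses (completeGraph (Fin 4))).Nonempty :=
  ⟨_, _, circulantGraph ({1, 4} : Set (Fin 8)), rfl,
    IsColoringFor.defines (c := ![0, 0, 1, 1, 2, 2, 3, 3])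
      (by decide +kernel) (encard_neighborSet_le_of_card_filter (by decide +kernel))⟩

theorem definingClasses_cycleGraph_five_nonempty :
    (definingClasses (cycleGraph 5)).Nonempty :=
  ⟨_, _, circulantGraph ({1, 4} : Set (Fin 8)), rfl,
    IsColoringFor.defines (c := ![0, 0, 1, 1, 2, 3, 3, 4])
      (by decide +kernel) (encard_neighborSet_le_of_card_filter (by decide +kernel))⟩

theorem definingClasses_threeK2_nonempty :
    (definingClasses threeK2).Nonempty :=
  ⟨_, _, graphOn 6 {s(0, 1), s(0, 4), s(0, 5), s(1, 3),
      s(1, 5), s(2, 3), s(2, 4), s(2, 5), s(3, 4)}, rfl,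
    IsColoringFor.defines (c := ![0, 2, 4, 3, 1, 5])
      (by decide +kernel) (encard_neighborSet_le_of_card_filter (by decide +kernel))⟩

/-- The circulant graph is `K_{3,3}`, in which one vertex from each side form a connected dominating
set. Here two vertices of one side are merged into one part. -/
theorem definingClasses_completeBipartiteGraph_two_three_nonempty :
    (definingClasses (completeBipartiteGraph (Fin 2) (Fin 3))).Nonempty :=
  ⟨_, _, circulantGraph ({1, 3} : Set (Fin 6)), rfl,
    IsColoringFor.defines (c := ![.inl 0, .inr 0, .inl 0, .inr 1, .inl 1, .inr 2])
      (by decide +kernel) (encard_neighborSet_le_of_card_filter (by decide +kernel))⟩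

theorem definingClasses_completeBipartiteGraph_three_three_nonempty :
    (definingClasses (completeBipartiteGraph (Fin 3) (Fin 3))).Nonempty :=
  ⟨_, _, circulantGraph ({1, 3} : Set (Fin 6)), rfl,
    IsColoringFor.defines (c := ![.inl 0, .inr 0, .inl 1, .inr 1, .inl 2, .inr 2])
      (by decide +kernel) (encard_neighborSet_le_of_card_filter (by decide +kernel))⟩

end SmallGraphs

/-! ### Edge counts in subcubic graphs -/

section Counting

open scoped Classical in
/-- The number of neighbours of `x` in `Y`. -/
noncomputable def degIn {V : Type*} (G : SimpleGraph V) (x : V) (Y : Finset V) : ℕ :=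
  (Y.filter fun y => G.Adj x y).card

/-- The number of ordered pairs of adjacent vertices in `X × Y`. -/
noncomputable def darts {V : Type*} (G : SimpleGraph V) (X Y : Finset V) : ℕ :=
  ∑ x ∈ X, degIn G x Y

variable {V : Type*} [DecidableEq V] {G : SimpleGraph V}

theorem degIn_union {x : V} {Y Z : Finset V} (h : Disjoint Y Z) :
    degIn G x (Y ∪ Z) = degIn G x Y + degIn G x Z := by
  classical
  simp only [degIn]
  rw [Finset.filter_union, Finset.card_union_of_disjoint (Finset.disjoint_filter_filter h)]

omit [DecidableEq V] in
theorem one_le_degIn {x y : V} {Y : Finset V} (hy : y ∈ Y) (h : G.Adj x y) :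
    1 ≤ degIn G x Y :=
  Finset.card_pos.2 ⟨y, by simp [hy, h]⟩

omit [DecidableEq V] in
theorem degIn_mono {x : V} {Y Z : Finset V} (h : Y ⊆ Z) : degIn G x Y ≤ degIn G x Z := by
  classical
  exact Finset.card_le_card (Finset.filter_subset_filter _ h)

theorem darts_union_left {X Y Z : Finset V} (h : Disjoint X Y) :
    darts G (X ∪ Y) Z = darts G X Z + darts G Y Z :=
  Finset.sum_union h

theorem darts_union_right {X Y Z : Finset V} (h : Disjoint Y Z) :
    darts G X (Y ∪ Z) = darts G X Y + darts G X Z := by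
  simp only [darts, degIn_union h, Finset.sum_add_distrib]

omit [DecidableEq V] in
theorem darts_comm (X Y : Finset V) : darts G X Y = darts G Y X := by
  classical
  simp only [darts, degIn, Finset.card_filter]
  rw [Finset.sum_comm]
  simp only [G.adj_comm]

omit [DecidableEq V] in
@[simp] theorem darts_singleton_left (x : V) (Y : Finset V) : darts G {x} Y = degIn G x Y := by
  simp [darts]

omit [DecidableEq V] in
@[simp] theorem degIn_singleton_self (x : V) : degIn G x {x} = 0 := by
  simp [degIn, Finset.filter_singleton]

omit [DecidableEq V] in
theorem card_le_darts {X Y : Finset V} (h : ∀ x ∈ X, 1 ≤ degIn G x Y) : X.card ≤ darts G X Y := by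
  simpa [darts] using Finset.card_nsmul_le_sum X (fun x => degIn G x Y) 1 h

theorem darts_insert_self {x : V} {X : Finset V} (hx : x ∉ X) :
    darts G (insert x X) (insert x X) = darts G X X + 2 * degIn G x X := by
  have hd : Disjoint {x} X := Finset.disjoint_singleton_left.2 hx
  rw [Finset.insert_eq, darts_union_left hd, darts_union_right hd, darts_union_right hd,
    darts_comm X {x}]
  simp only [darts_singleton_left, degIn_singleton_self]
  omega

omit [DecidableEq V] in
theorem even_darts_self (X : Finset V) : Even (darts G X X) := by
  classical
  induction X using Finset.induction_on with
  | empty => simp [darts]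
  | insert x X hx ih =>
    rw [darts_insert_self hx]
    exact ih.add (even_two_mul _)

theorem darts_union_self {X Y : Finset V} (h : Disjoint X Y) :
    darts G (X ∪ Y) (X ∪ Y) = darts G X X + darts G Y Y + 2 * darts G X Y := by
  rw [darts_union_left h, darts_union_right h, darts_union_right h, darts_comm Y X]
  omega

theorem exists_adj_of_connected_union {S R : Finset V} (hd : Disjoint S R) (hS : S.Nonempty)
    (hR : R.Nonempty) (h : (G.induce (S ∪ R : Finset V)).Connected) :
    ∃ s ∈ S, ∃ r ∈ R, G.Adj s r := by
  obtain ⟨s, hs⟩ := hS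
  obtain ⟨r, hr⟩ := hR
  obtain ⟨p⟩ := h.preconnected ⟨s, by simp [hs]⟩ ⟨r, by simp [hr]⟩
  obtain ⟨d, -, h1, h2⟩ := p.exists_boundary_dart {x | x.1 ∈ S} hs
    (Finset.disjoint_right.1 hd hr)
  have hmem := d.toProd.2.2
  rw [Finset.mem_coe, Finset.mem_union] at hmem
  exact ⟨_, h1, _, hmem.resolve_left h2, d.adj⟩

/-- In a connected graph on `S ∪ R` with `R` nonempty, at least `|S|` edges meet `S`. -/
theorem two_mul_card_le_darts {S R : Finset V} (hd : Disjoint S R) (hR : R.Nonempty)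
    (h : (G.induce (S ∪ R : Finset V)).Connected) :
    2 * S.card ≤ darts G S S + 2 * darts G S R := by
  induction hn : S.card generalizing S R with
  | zero => simp
  | succ n ih =>
    -- Move `s` from `S` to `R`: the edges meeting `S` but not `S.erase s` are those from `s` to
    -- `R`, and there is at least one.
    obtain ⟨s, hs, r, hr, hsr⟩ :=
      exists_adj_of_connected_union hd (Finset.card_pos.1 (by omega)) hR h
    have hsR : s ∉ R := Finset.disjoint_left.1 hd hs
    have hsS : s ∉ S.erase s := Finset.notMem_erase s S
    have hSe : insert s (S.erase s) = S := Finset.insert_erase hs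
    have hd' : Disjoint (S.erase s) (insert s R) := by
      rw [Finset.disjoint_insert_right]
      exact ⟨hsS, hd.mono_left (Finset.erase_subset s S)⟩
    have hun : S.erase s ∪ insert s R = S ∪ R := by
      rw [Finset.union_insert, ← Finset.insert_union, hSe]
    have := ih hd' (Finset.insert_nonempty s R) (by rw [hun]; exact h)
      (by rw [Finset.card_erase_of_mem hs]; omega)
    have h1 := darts_insert_self (G := G) hsS
    rw [hSe] at h1
    have h2 : darts G (S.erase s) (insert s R) = degIn G s (S.erase s) + darts G (S.erase s) R := by
      rw [Finset.insert_eq, darts_union_right (Finset.disjoint_singleton_left.2 hsR),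
        darts_comm, darts_singleton_left]
    have h3 : darts G S R = degIn G s R + darts G (S.erase s) R := by
      conv_lhs => rw [← hSe]
      rw [Finset.insert_eq, darts_union_left (Finset.disjoint_singleton_left.2 hsS),
        darts_singleton_left]
    have h4 := one_le_degIn hr hsr
    omega

theorem two_mul_card_le_darts_self {D : Finset V} (h : (G.induce (D : Set V)).Connected) :
    2 * D.card ≤ darts G D D + 2 := by
  obtain ⟨⟨r, hr⟩⟩ := h.nonempty
  have hr' : r ∈ D := hr
  have hrD : r ∉ D.erase r := Finset.notMem_erase r D
  have hD : D.erase r ∪ {r} = D := by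
    rw [Finset.union_comm, ← Finset.insert_eq, Finset.insert_erase hr']
  have h1 := two_mul_card_le_darts (G := G) (S := D.erase r) (R := {r})
    (Finset.disjoint_singleton_right.2 hrD) (Finset.singleton_nonempty r) (by rw [hD]; exact h)
  have h2 := darts_insert_self (G := G) hrD
  rw [Finset.insert_erase hr'] at h2
  rw [darts_comm _ {r}, darts_singleton_left, Finset.card_erase_of_mem hr'] at h1
  omega

theorem IsConnDominating.one_le_degIn {X Y : Finset V} (hd : Disjoint X Y)
    (h : IsConnDominating G (X ∪ Y : Finset V)) {x : V} (hX : x ∉ X) (hY : x ∉ Y) :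
    1 ≤ degIn G x X + degIn G x Y := by
  obtain ⟨u, hu, hxu⟩ := h.1 x (by simp [hX, hY])
  rw [← degIn_union hd]
  exact CoalitionGraphs.one_le_degIn hu hxu

omit [DecidableEq V] in
theorem IsSubcubic.degIn_le (hG : IsSubcubic G) (x : V) (Y : Finset V) : degIn G x Y ≤ 3 := by
  classical
  have h := hG.2 x
  have hsub : ((Y.filter fun y => G.Adj x y : Finset V) : Set V) ⊆ G.neighborSet x := by
    intro y hy
    simpa using (Finset.mem_filter.1 hy).2
  have := (Set.encard_le_encard hsub).trans h
  rw [Set.encard_coe_eq_coe_finsetCard] at this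
  rw [degIn]
  convert (by exact_mod_cast this : (Y.filter fun y => G.Adj x y).card ≤ 3)

/-- A connected dominating set of a subcubic graph contains almost half of the vertices. -/
theorem IsConnDominating.card_le [Fintype V] (hG : IsSubcubic G) {D : Finset V}
    (h : IsConnDominating G (D : Set V)) : Fintype.card V ≤ 2 * D.card + 2 := by
  -- Of the at most `3|D|` darts that start in `D`, at least `2|D| - 2` stay inside, so at most `|D|
  -- + 2` are left to dominate the complement.
  have h1 := two_mul_card_le_darts_self h.2
  have h2 : Dᶜ.card ≤ darts G Dᶜ D := by
    refine card_le_darts fun x hx => ?_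
    obtain ⟨u, hu, hxu⟩ := h.1 x (by simpa using hx)
    exact CoalitionGraphs.one_le_degIn hu hxu
  have h3 : darts G D D + darts G D Dᶜ ≤ 3 * D.card := by
    rw [← darts_union_right disjoint_compl_right]
    simpa [darts, Nat.mul_comm] using
      Finset.sum_le_card_nsmul D _ 3 fun x _ => hG.degIn_le x (D ∪ Dᶜ)
  rw [darts_comm] at h2
  have h4 := Finset.card_add_card_compl D
  omega

end Counting

/-! ### Upper bounds for the order -/

section Bounds

variable {V : Type*} {W : Type*} {G : SimpleGraph V}

open scoped Classical in
/-- The colour classes of a colouring. -/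
noncomputable def colorClass [Fintype V] (c : V → W) (i : W) : Finset V :=
  Finset.univ.filter fun v => c v = i

theorem mem_colorClass [Fintype V] {c : V → W} {i : W} {v : V} :
    v ∈ colorClass c i ↔ c v = i := by
  simp [colorClass]

theorem disjoint_colorClass [Fintype V] {c : V → W} {i j : W} (h : i ≠ j) :
    Disjoint (colorClass c i) (colorClass c j) :=
  Finset.disjoint_left.2 fun _ hi hj => h ((mem_colorClass.1 hi).symm.trans (mem_colorClass.1 hj))

theorem sum_card_colorClass [Fintype V] [Fintype W] (c : V → W) :
    ∑ i, (colorClass c i).card = Fintype.card V := by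
  classical
  rw [← Finset.card_univ, Finset.card_eq_sum_card_fiberwise (f := c) (t := Finset.univ) (by simp)]
  refine Finset.sum_congr rfl fun i _ => ?_
  rw [colorClass]

theorem sum_degIn_colorClass_le [Fintype V] [Fintype W] (hG : IsSubcubic G) (c : V → W) (x : V) :
    ∑ i, degIn G x (colorClass c i) ≤ 3 := by
  classical
  refine le_of_eq_of_le ?_ (hG.degIn_le x Finset.univ)
  rw [degIn, Finset.card_eq_sum_card_fiberwise (f := c) (t := Finset.univ) (by simp)]
  refine Finset.sum_congr rfl fun i _ => ?_
  rw [degIn, colorClass, Finset.filter_filter, Finset.filter_filter]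
  congr 1
  ext v
  simp [and_comm]

theorem sum_darts_colorClass_le [Fintype V] [Fintype W] (hG : IsSubcubic G) (c : V → W)
    (X : Finset V) : ∑ i, darts G X (colorClass c i) ≤ 3 * X.card := by
  simp only [darts]
  rw [Finset.sum_comm]
  simpa [Nat.mul_comm] using
    Finset.sum_le_card_nsmul X _ 3 fun x _ => sum_degIn_colorClass_le hG c x

theorem isConnDominating_colorClass_union [DecidableEq V] [Fintype V] {H : SimpleGraph W}
    {c : V → W}
    (hadj : ∀ i j, H.Adj i j ↔ IsCoalition G (c ⁻¹' {i}) (c ⁻¹' {j})) {i j : W} (h : H.Adj i j) :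
    IsConnDominating G (colorClass c i ∪ colorClass c j : Finset V) := by
  have : ((colorClass c i ∪ colorClass c j : Finset V) : Set V) = c ⁻¹' {i} ∪ c ⁻¹' {j} := by
    ext v
    simp [mem_colorClass]
  rw [this]
  exact ((hadj i j).1 h).2.2.2

theorem Defines.exists_coloring [Fintype V] {H : SimpleGraph W} (h : Defines G H) :
    ∃ c : V → W, (∀ i, (colorClass c i).Nonempty) ∧
      ∀ [DecidableEq V] {i j}, H.Adj i j →
        IsConnDominating G (colorClass c i ∪ colorClass c j : Finset V) ∧
        Fintype.card V ≤ 2 * ((colorClass c i).card + (colorClass c j).card) + 2 := by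
  obtain ⟨hG, c, hc, hadj, -⟩ := defines_iff_exists_coloring.1 h
  refine ⟨c, fun i => ?_, fun {_ i j} hij => ?_⟩
  · obtain ⟨v, hv⟩ := hc i
    exact ⟨v, mem_colorClass.2 hv⟩
  · have hcd := isConnDominating_colorClass_union hadj hij
    refine ⟨hcd, ?_⟩
    rw [← Finset.card_union_of_disjoint (disjoint_colorClass hij.ne)]
    exact hcd.card_le hG

/-- A graph that defines an edgeless graph has the same order. -/
theorem Defines.card_eq_of_forall_not_adj [Finite V] [Finite W] {H : SimpleGraph W}
    (h : Defines G H) (hH : ∀ i j, ¬ H.Adj i j) : Nat.card V = Nat.card W := by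
  obtain ⟨-, c, hc, -, hmem⟩ := defines_iff_exists_coloring.1 h
  refine Nat.card_congr (Equiv.ofBijective c ⟨fun x y hxy => ?_, hc⟩)
  obtain ⟨⟨v, hv⟩, -⟩ := (hmem (c x)).resolve_right fun ⟨j, hj⟩ => hH _ _ hj
  have hx : x ∈ c ⁻¹' {c x} := rfl
  have hy : y ∈ c ⁻¹' {c x} := hxy.symm
  rw [hv] at hx hy
  exact Eq.trans hx (Eq.symm hy)

/-- Each class lies in two of the five coalitions, so adding their bounds gives `5n ≤ 4n + 10`. -/
theorem Defines.card_le_of_cycleGraph_five [Finite V] (h : Defines G (cycleGraph 5)) :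
    Nat.card V ≤ 10 := by
  classical
  have := Fintype.ofFinite V
  obtain ⟨c, -, hc⟩ := h.exists_coloring
  have h0 := (hc (show (cycleGraph 5).Adj 0 1 by decide)).2
  have h1 := (hc (show (cycleGraph 5).Adj 1 2 by decide)).2
  have h2 := (hc (show (cycleGraph 5).Adj 2 3 by decide)).2
  have h3 := (hc (show (cycleGraph 5).Adj 3 4 by decide)).2
  have h4 := (hc (show (cycleGraph 5).Adj 4 0 by decide)).2
  have hs := sum_card_colorClass c
  rw [Fin.sum_univ_five] at hs
  rw [Nat.card_eq_fintype_card]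
  omega

/-- The three coalitions partition the vertices, so `3n ≤ 2n + 6`. -/
theorem Defines.card_le_of_threeK2 [Finite V] (h : Defines G threeK2) : Nat.card V ≤ 10 := by
  classical
  have := Fintype.ofFinite V
  obtain ⟨c, -, hc⟩ := h.exists_coloring
  have h0 := (hc (show threeK2.Adj 0 1 by decide)).2
  have h1 := (hc (show threeK2.Adj 2 3 by decide)).2
  have h2 := (hc (show threeK2.Adj 4 5 by decide)).2
  have hs := sum_card_colorClass c
  rw [Fin.sum_univ_six] at hs
  rw [Nat.card_eq_fintype_card]
  omega

theorem Defines.card_le_of_completeBipartiteGraph_three_three [Finite V]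
    (h : Defines G (completeBipartiteGraph (Fin 3) (Fin 3))) : Nat.card V ≤ 10 := by
  classical
  have := Fintype.ofFinite V
  obtain ⟨c, -, hc⟩ := h.exists_coloring
  have hp : ∀ i, _ := fun i : Fin 3 => (hc (i := .inl i) (j := .inr i) (by simp)).2
  have h0 := hp 0
  have h1 := hp 1
  have h2 := hp 2
  have hs := sum_card_colorClass c
  rw [Fintype.sum_sum_type, Fin.sum_univ_three, Fin.sum_univ_three] at hs
  rw [Nat.card_eq_fintype_card]
  omega

/-- Adding the six bounds `n ≤ 2|D| + 2` only gives `6n ≤ 6n + 12`. The additional fact is that the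
edges inside a class form a matching. -/
theorem Defines.card_le_of_completeGraph_four [Finite V] (h : Defines G (completeGraph (Fin 4))) :
    Nat.card V ≤ 10 := by
  classical
  have := Fintype.ofFinite V
  obtain ⟨c, -, hc⟩ := h.exists_coloring
  have hG := h.1
  have hdom : ∀ (x : V) (i j : Fin 4), i ≠ j → c x ≠ i → c x ≠ j →
      1 ≤ degIn G x (colorClass c i) + degIn G x (colorClass c j) := fun x i j hij hi hj =>
    (hc (show (completeGraph (Fin 4)).Adj i j from hij)).1.one_le_degIn
      (disjoint_colorClass hij) (fun hx => hi (mem_colorClass.1 hx))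
      (fun hx => hj (mem_colorClass.1 hx))
  -- Any two of the other three classes together contain a neighbour of `x`, so at most one of the
  -- three has none, and at most one neighbour remains for the class of `x`.
  have hself : ∀ x, degIn G x (colorClass c (c x)) ≤ 1 := by
    intro x
    have hrow := sum_degIn_colorClass_le hG c x
    rw [Fin.sum_univ_four] at hrow
    have hx := hdom x
    generalize c x = i at hx ⊢
    obtain rfl | rfl | rfl | rfl : i = 0 ∨ i = 1 ∨ i = 2 ∨ i = 3 := by omega
    · have h1 := hx 1 2 (by decide) (by decide) (by decide)
      have h2 := hx 1 3 (by decide) (by decide) (by decide)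
      have h3 := hx 2 3 (by decide) (by decide) (by decide)
      omega
    · have h1 := hx 0 2 (by decide) (by decide) (by decide)
      have h2 := hx 0 3 (by decide) (by decide) (by decide)
      have h3 := hx 2 3 (by decide) (by decide) (by decide)
      omega
    · have h1 := hx 0 1 (by decide) (by decide) (by decide)
      have h2 := hx 0 3 (by decide) (by decide) (by decide)
      have h3 := hx 1 3 (by decide) (by decide) (by decide)
      omega
    · have h1 := hx 0 1 (by decide) (by decide) (by decide)
      have h2 := hx 0 2 (by decide) (by decide) (by decide)
      have h3 := hx 1 2 (by decide) (by decide) (by decide)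
      omega
  have hdd : ∀ i, darts G (colorClass c i) (colorClass c i) ≤ (colorClass c i).card := by
    intro i
    have := Finset.sum_le_card_nsmul (colorClass c i) (fun x => degIn G x (colorClass c i)) 1
      (fun x hx => by
        have := hself x
        rwa [mem_colorClass.1 hx] at this)
    simpa [darts] using this
  have hpair : ∀ i j, i ≠ j → 2 * ((colorClass c i).card + (colorClass c j).card) ≤
      darts G (colorClass c i) (colorClass c i) + darts G (colorClass c j) (colorClass c j) +
        2 * darts G (colorClass c i) (colorClass c j) + 2 := by
    intro i j hij
    rw [← darts_union_self (disjoint_colorClass hij),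
      ← Finset.card_union_of_disjoint (disjoint_colorClass hij)]
    exact two_mul_card_le_darts_self (hc (show (completeGraph (Fin 4)).Adj i j from hij)).1.2
  have hrow : ∀ i, _ := fun i => sum_darts_colorClass_le hG c (colorClass c i)
  simp only [Fin.sum_univ_four] at hrow
  have hev : ∀ i, ∃ e, darts G (colorClass c i) (colorClass c i) = e + e := fun i =>
    even_darts_self _
  have hcard : ∀ i j, i ≠ j → _ := fun i j hij =>
    (hc (show (completeGraph (Fin 4)).Adj i j from hij)).2
  have hs := sum_card_colorClass c
  rw [Fin.sum_univ_four] at hs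
  rw [Nat.card_eq_fintype_card]
  have p01 := hpair 0 1 (by decide)
  have p02 := hpair 0 2 (by decide)
  have p03 := hpair 0 3 (by decide)
  have p12 := hpair 1 2 (by decide)
  have p13 := hpair 1 3 (by decide)
  have p23 := hpair 2 3 (by decide)
  have r0 := hrow 0
  have r1 := hrow 1
  have r2 := hrow 2
  have r3 := hrow 3
  rw [darts_comm (colorClass c 1) (colorClass c 0)] at r1
  rw [darts_comm (colorClass c 2) (colorClass c 0), darts_comm (colorClass c 2) (colorClass c 1)]
    at r2
  rw [darts_comm (colorClass c 3) (colorClass c 0), darts_comm (colorClass c 3) (colorClass c 1),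
    darts_comm (colorClass c 3) (colorClass c 2)] at r3
  have d0 := hdd 0
  have d1 := hdd 1
  have d2 := hdd 2
  have d3 := hdd 3
  obtain ⟨e0, h0⟩ := hev 0
  obtain ⟨e1, h1⟩ := hev 1
  obtain ⟨e2, h2⟩ := hev 2
  obtain ⟨e3, h3⟩ := hev 3
  have c01 := hcard 0 1 (by decide)
  have c02 := hcard 0 2 (by decide)
  have c12 := hcard 1 2 (by decide)
  have c03 := hcard 0 3 (by decide)
  have c13 := hcard 1 3 (by decide)
  have c23 := hcard 2 3 (by decide)
  -- With `E` edges inside classes and `F` between them, the six pairs give `3n ≤ 3E + F + 6`, and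
  -- the degrees give `2E + 2F ≤ 3n`.
  have hlow : 3 * Fintype.card V ≤ 4 * (e0 + e1 + e2 + e3) + 12 := by omega
  rw [h0] at d0
  rw [h1] at d1
  rw [h2] at d2
  rw [h3] at d3
  clear hdom hself hdd hpair hrow hev hcard p01 p02 p03 p12 p13 p23 r0 r1 r2 r3 h0 h1 h2 h3
  by_contra hcon
  -- Since `2E ≤ n`, this leaves only `n = 12` with `E = 6`, all matchings then being perfect; for
  -- `n = 11` the two bounds on `E` conflict.
  have hle : Fintype.card V ≤ 12 := by clear c01 c02 c12 c03 c13 c23; omega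
  have hE : e0 + e1 + e2 + e3 ≤ 6 := by clear c01 c02 c12 c03 c13 c23; omega
  have hn : Fintype.card V = 12 := by clear c01 c02 c12 c03 c13 c23; omega
  have s0 : (colorClass c 0).card = 2 * e0 := by clear c01 c02 c12 c03 c13 c23; omega
  have s1 : (colorClass c 1).card = 2 * e1 := by clear c01 c02 c12 c03 c13 c23; omega
  have s2 : (colorClass c 2).card = 2 * e2 := by clear c01 c02 c12 c03 c13 c23; omega
  have s3 : (colorClass c 3).card = 2 * e3 := by clear c01 c02 c12 c03 c13 c23; omega
  rw [s0, s1, s2, s3] at hs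
  rw [hn, s0, s1] at c01
  rw [hn, s0, s2] at c02
  rw [hn, s0, s3] at c03
  rw [hn, s1, s2] at c12
  rw [hn, s1, s3] at c13
  rw [hn, s2, s3] at c23
  clear d0 d1 d2 d3 s0 s1 s2 s3 hlow hcon hle hE
  -- Each pair sum is at least `3` and complementary pairs add up to `6`, so every pair sum is `3`.
  -- Three of them give `2 * (e0 + e1 + e2) = 9`, which is impossible by parity.
  have t01 : e0 + e1 = 3 := by omega
  have t02 : e0 + e2 = 3 := by omega
  have t12 : e1 + e2 = 3 := by omega
  omega

/-- If `A` and each of three disjoint sets `B j` induce connected graphs, and each vertex of `A`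
has a neighbour in `A'` or in each of the sets `B j`, then the latter holds throughout. -/
theorem degIn_eq_of_connected_union_three [DecidableEq V] {A A' : Finset V} {B : Fin 3 → Finset V}
    (hrow : ∀ x ∈ A, degIn G x A + degIn G x A' + ∑ j, degIn G x (B j) ≤ 3)
    (hdom : ∀ x ∈ A, ∀ j, 1 ≤ degIn G x A' + degIn G x (B j))
    (hB : ∀ j, (B j).Nonempty) (hd : ∀ j, Disjoint A (B j))
    (hconn : ∀ j, (G.induce (A ∪ B j : Finset V)).Connected) :
    ∀ x ∈ A, degIn G x A = 0 ∧ ∀ j, degIn G x (B j) = 1 := by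
  simp only [Fin.sum_univ_three] at hrow
  have hgood : ∀ x ∈ A, degIn G x A' = 0 → degIn G x A = 0 ∧ ∀ j, degIn G x (B j) = 1 := by
    intro x hx h0
    have h1 := hrow x hx
    have h2 := hdom x hx 0
    have h3 := hdom x hx 1
    have h4 := hdom x hx 2
    refine ⟨by omega, fun j => ?_⟩
    obtain rfl | rfl | rfl : j = 0 ∨ j = 1 ∨ j = 2 := by omega
    all_goals omega
  -- The claim is that `X` is empty. By `hgood`, the vertices of `Y` have no neighbours in `A`, so
  -- in each connected graph on `A ∪ B j` the set `X` is attached through `B j` alone.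
  set X := A.filter fun x => 1 ≤ degIn G x A' with hX
  set Y := A.filter fun x => ¬ 1 ≤ degIn G x A' with hY
  have hXY : X ∪ Y = A := Finset.filter_union_filter_not_eq _ _
  have hdXY : Disjoint X Y := Finset.disjoint_filter_filter_not _ _ _
  rcases X.eq_empty_or_nonempty with hemp | hne
  · intro x hx
    refine hgood x hx ?_
    by_contra hpos
    have : x ∈ X := Finset.mem_filter.2 ⟨hx, by omega⟩
    simp [hemp] at this
  exfalso
  have hXA : X ⊆ A := Finset.filter_subset _ _
  have hYX : darts G X Y = 0 := by
    rw [darts_comm]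
    refine Finset.sum_eq_zero fun y hy => ?_
    have hy' := Finset.mem_filter.1 hy
    have := (hgood y hy'.1 (by omega)).1
    have := degIn_mono (G := G) (x := y) hXA
    omega
  have hdX : ∀ j, Disjoint X (B j) := fun j => (hd j).mono_left hXA
  have hdY : ∀ j, Disjoint Y (B j) := fun j => (hd j).mono_left (Finset.filter_subset _ _)
  have hR : ∀ j, darts G X (Y ∪ B j) = darts G X (B j) := fun j => by
    rw [darts_union_right (hdY j), hYX, zero_add]
  have hconn' : ∀ j, (G.induce (X ∪ (Y ∪ B j) : Finset V)).Connected := fun j => by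
    rw [← Finset.union_assoc, hXY]
    exact hconn j
  have hdisj : ∀ j, Disjoint X (Y ∪ B j) := fun j =>
    Finset.disjoint_union_right.2 ⟨hdXY, hdX j⟩
  have hne' : ∀ j, (Y ∪ B j).Nonempty := fun j => (hB j).mono Finset.subset_union_right
  have hedge : ∀ j, 2 * X.card ≤ darts G X X + 2 * darts G X (B j) := fun j => by
    rw [← hR]
    exact two_mul_card_le_darts (hdisj j) (hne' j) (hconn' j)
  have hpos : ∀ j, 1 ≤ darts G X (B j) := fun j => by
    obtain ⟨s, hs, r, hr, hsr⟩ := exists_adj_of_connected_union (hdisj j) hne (hne' j) (hconn' j)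
    rw [← hR]
    exact (one_le_degIn hr hsr).trans
      (Finset.single_le_sum (f := fun x => degIn G x (Y ∪ B j)) (fun _ _ => Nat.zero_le _) hs)
  have hsum : darts G X X + X.card + (darts G X (B 0) + darts G X (B 1) + darts G X (B 2)) ≤
      3 * X.card := by
    have : ∑ x ∈ X, (degIn G x X + 1 +
        (degIn G x (B 0) + degIn G x (B 1) + degIn G x (B 2))) ≤ X.card * 3 :=
      Finset.sum_le_card_nsmul X _ 3 fun x hx => by
        have h1 := hrow x (hXA hx)
        have h2 := (Finset.mem_filter.1 hx).2
        have h3 := degIn_mono (G := G) (x := x) hXA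
        omega
    simp only [Finset.sum_add_distrib, Finset.sum_const, smul_eq_mul, mul_one] at this
    simp only [darts]
    omega
  -- Two of the edge bounds give `darts G X (B 1) + darts G X (B 2) ≥ 2|X| - darts G X X`, which
  -- uses up the whole degree budget of `hsum`; the dart to `B 0` exceeds it.
  have e0 := hedge 0
  have e1 := hedge 1
  have e2 := hedge 2
  have p0 := hpos 0
  omega

/-- By `degIn_eq_of_connected_union_three`, the classes `A i` are independent and each of their
vertices has exactly one neighbour in each `B j`. Such vertices are leaves in the graph on `A i ∪ B
j`, so `B j` alone spans at least `|B j| - 1` edges, and its remaining degrees bound `|A 0| + |A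
1|`. -/
theorem Defines.card_le_of_completeBipartiteGraph_two_three [Finite V]
    (h : Defines G (completeBipartiteGraph (Fin 2) (Fin 3))) : Nat.card V ≤ 10 := by
  classical
  have := Fintype.ofFinite V
  obtain ⟨c, hne, hc⟩ := h.exists_coloring
  have hG := h.1
  set A : Fin 2 → Finset V := fun i => colorClass c (.inl i) with hA
  set B : Fin 3 → Finset V := fun j => colorClass c (.inr j) with hB
  have hdAB : ∀ i j, Disjoint (A i) (B j) := fun i j => disjoint_colorClass (by simp)
  have hcd : ∀ i j, IsConnDominating G (A i ∪ B j : Finset V) := fun i j =>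
    (hc (i := .inl i) (j := .inr j) (by simp)).1
  have hcard : ∀ i j, Fintype.card V ≤ 2 * ((A i).card + (B j).card) + 2 := fun i j =>
    (hc (i := .inl i) (j := .inr j) (by simp)).2
  have hrow : ∀ x, degIn G x (A 0) + degIn G x (A 1) + ∑ j, degIn G x (B j) ≤ 3 := fun x => by
    have := sum_degIn_colorClass_le hG c x
    rwa [Fintype.sum_sum_type, Fin.sum_univ_two] at this
  have hdom : ∀ i i' j, i' ≠ i → ∀ x ∈ A i, 1 ≤ degIn G x (A i') + degIn G x (B j) :=
    fun i i' j hi x hx => (hcd i' j).one_le_degIn (hdAB i' j)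
      (Finset.disjoint_left.1 (disjoint_colorClass (by simpa using hi.symm)) hx)
      (Finset.disjoint_left.1 (hdAB i j) hx)
  have hdeg : ∀ i, ∀ x ∈ A i, degIn G x (A i) = 0 ∧ ∀ j, degIn G x (B j) = 1 := by
    intro i
    obtain rfl | rfl : i = 0 ∨ i = 1 := by omega
    · exact degIn_eq_of_connected_union_three (A' := A 1) (fun x _ => hrow x)
        (fun x hx j => hdom 0 1 j (by decide) x hx) (fun j => hne _) (hdAB 0)
        (fun j => (hcd 0 j).2)
    · exact degIn_eq_of_connected_union_three (A' := A 0)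
        (fun x _ => by rw [add_comm (degIn G x (A 1))]; exact hrow x)
        (fun x hx j => hdom 1 0 j (by decide) x hx) (fun j => hne _) (hdAB 1)
        (fun j => (hcd 1 j).2)
  have hAA : ∀ i, darts G (A i) (A i) = 0 := fun i =>
    Finset.sum_eq_zero fun x hx => (hdeg i x hx).1
  have hAB : ∀ i j, darts G (A i) (B j) = (A i).card := fun i j => by
    rw [darts, Finset.sum_congr rfl fun x hx => (hdeg i x hx).2 j]
    simp
  have hBB : ∀ j, 2 * (B j).card ≤ darts G (B j) (B j) + 2 := fun j => by
    have := two_mul_card_le_darts_self (hcd 0 j).2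
    rw [darts_union_self (hdAB 0 j), Finset.card_union_of_disjoint (hdAB 0 j), hAA, hAB] at this
    omega
  have hBrow : ∀ j, (A 0).card + (A 1).card + darts G (B j) (B j) ≤ 3 * (B j).card := fun j => by
    have := sum_darts_colorClass_le hG c (B j)
    rw [Fintype.sum_sum_type, Fin.sum_univ_two] at this
    have hle := Finset.single_le_sum (f := fun k => darts G (B j) (colorClass c (.inr k)))
      (fun _ _ => Nat.zero_le _) (Finset.mem_univ j)
    have h0 := hAB 0 j
    have h1 := hAB 1 j
    rw [darts_comm] at h0 h1
    simp only [hA, hB] at *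
    omega
  have hs := sum_card_colorClass c
  rw [Fintype.sum_sum_type, Fin.sum_univ_two, Fin.sum_univ_three] at hs
  change (A 0).card + (A 1).card + ((B 0).card + (B 1).card + (B 2).card) = _ at hs
  rw [Nat.card_eq_fintype_card]
  -- With `a` and `b` the total sizes of the `A i` and of the `B j`, the bounds `hcard` for both `i`
  -- give `b ≤ 2|B j| + 2`, and summing over `j` gives `b ≤ 6`. Some `B j` has at most two vertices,
  -- and `a ≤ |B j| + 2` yields `a ≤ 4`.
  have b0 := hBB 0
  have b1 := hBB 1
  have b2 := hBB 2
  have r0 := hBrow 0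
  have r1 := hBrow 1
  have r2 := hBrow 2
  have c00 := hcard 0 0
  have c01 := hcard 0 1
  have c02 := hcard 0 2
  have c10 := hcard 1 0
  have c11 := hcard 1 1
  have c12 := hcard 1 2
  omega

end Bounds

/-! ### Finitely defined graphs -/

section FinitelyDefined

variable {W : Type} {H : SimpleGraph W}

/-- The bound is needed twice: in the universe `u` of the statement, and in `Type`, where the graphs
on `Fin n` that represent the classes live. -/
theorem finitelyDefined_of_card_le (hne : (definingClasses H).Nonempty)
    (h : ∀ (V : Type u) [Finite V] (G : SimpleGraph V), Defines G H → Nat.card V ≤ 10)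
    (h' : ∀ (V : Type) [Finite V] (G : SimpleGraph V), Defines G H → Nat.card V ≤ 10) :
    FinitelyDefined.{u} H := by
  refine ⟨hne, h, ((Set.finite_Iic 10).biUnion fun n _ =>
    Set.finite_range fun G : SimpleGraph (Fin n) => graphClass G).subset ?_⟩
  rintro _ ⟨n, G, rfl, hG⟩
  have := h' _ G hG
  rw [Nat.card_fin] at this
  exact Set.mem_biUnion (show n ∈ Set.Iic 10 from this) ⟨G, rfl⟩

theorem isConnDominating_singleton_top {V : Type*} (v : V) :
    IsConnDominating (⊤ : SimpleGraph V) {v} := by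
  refine ⟨fun w hw => ⟨v, rfl, hw⟩, ?_⟩
  have : Nonempty ({v} : Set V) := ⟨⟨v, rfl⟩⟩
  exact ⟨fun x y => by rw [Subsingleton.elim x y]⟩

/-- The complete graphs of order at most four define the edgeless graphs. -/
theorem finitelyDefined_of_forall_not_adj {k : ℕ} (hk : 0 < k) (hk' : k ≤ 4)
    {H : SimpleGraph (Fin k)} (hH : ∀ i j, ¬ H.Adj i j) : FinitelyDefined.{u} H := by
  have hcard : ∀ (V : Type _) [Finite V] (G : SimpleGraph V), Defines G H → Nat.card V ≤ 10 := by
    intro V _ G hG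
    rw [hG.card_eq_of_forall_not_adj hH, Nat.card_fin]
    omega
  refine finitelyDefined_of_card_le ⟨_, k, ⊤, rfl, ?_⟩ hcard ?_
  · rw [defines_iff_exists_coloring]
    refine ⟨⟨(isConnDominating_singleton_top (⟨0, hk⟩ : Fin k)).connected, fun v => ?_⟩, id,
      Function.surjective_id, fun i j => iff_of_false (hH i j) fun h => h.2.1 ?_,
      fun i => Or.inl ⟨⟨i, rfl⟩, ?_⟩⟩
    · refine encard_neighborSet_le_of_card_filter (fun v => ?_) v
      have : (Finset.univ.filter fun w => (⊤ : SimpleGraph (Fin k)).Adj v w) ⊆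
          Finset.univ.erase v := by
        intro w hw
        have := (Finset.mem_filter.1 hw).2
        simpa using this.symm
      have := Finset.card_le_card this
      rw [Finset.card_erase_of_mem (Finset.mem_univ v), Finset.card_univ, Fintype.card_fin] at this
      omega
    · exact isConnDominating_singleton_top i
    · exact isConnDominating_singleton_top i
  · intro V _ G hG
    rw [hG.card_eq_of_forall_not_adj hH, Nat.card_fin]
    omega

end FinitelyDefined

/-! ### Stars -/

section Stars

variable {V : Type*} {G : SimpleGraph V}

theorem star_adj {k : ℕ} {i j : Fin k} :
    (star k).Adj i j ↔ i ≠ j ∧ (i.val = 0 ∨ j.val = 0) := Iff.rfl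

/-- Two connected sets with no edges between them, and independent further vertices with
neighbours in both sets, form the parts of a partition that defines a star. -/
theorem definesStarByPair_of_cover {K : ℕ} (hK : 0 < K) {V₁ V₂ : Set V} {v : Fin K → V}
    (hd : Disjoint V₁ V₂) (h₁ : (G.induce V₁).Connected) (h₂ : (G.induce V₂).Connected)
    (hno : ∀ x ∈ V₁, ∀ y ∈ V₂, ¬ G.Adj x y) (hv : Function.Injective v)
    (hvV : ∀ i, v i ∉ V₁ ∪ V₂) (hcover : ∀ x, x ∉ V₁ ∪ V₂ → ∃ i, v i = x)
    (hadj : ∀ i, (∃ x ∈ V₁, G.Adj (v i) x) ∧ ∃ y ∈ V₂, G.Adj (v i) y)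
    (hpair : ∀ i j, ∃ x, x ≠ v i ∧ x ≠ v j ∧ ¬ G.Adj x (v i) ∧ ¬ G.Adj x (v j)) :
    G.Connected ∧ DefinesStarByPair G (K + 1) := by
  have hpp : ∀ i j, ¬ IsConnDominating G ({v i} ∪ {v j}) := by
    intro i j h
    obtain ⟨x, hi, hj, hxi, hxj⟩ := hpair i j
    obtain ⟨u, rfl | rfl, hxu⟩ := h.1 x (by simp [hi, hj])
    · exact hxi hxu
    · exact hxj hxu
  have hp : ∀ i, ¬ IsConnDominating G {v i} := fun i h => hpp i i (by rwa [Set.union_self])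
  obtain ⟨⟨a, ha⟩⟩ := h₁.nonempty
  obtain ⟨⟨b, hb⟩⟩ := h₂.nonempty
  have hU : ¬ IsConnDominating G (V₁ ∪ V₂) := by
    intro h
    obtain ⟨p⟩ := h.2.preconnected ⟨a, Or.inl ha⟩ ⟨b, Or.inr hb⟩
    obtain ⟨d, -, hd1, hd2⟩ := p.exists_boundary_dart {x | x.1 ∈ V₁} ha
      (Set.disjoint_right.1 hd hb)
    exact hno _ hd1 _ (d.toProd.2.2.resolve_left hd2) d.adj
  -- The vertex `v i` links the two connected sets, and every other `v j` is dominated from `V₁`.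
  have hUv : ∀ i, IsConnDominating G (V₁ ∪ V₂ ∪ {v i}) := by
    intro i
    have hv1 : v i ∈ V₁ ∪ V₂ ∪ {v i} := Or.inr rfl
    have hreach : ∀ {S : Set V}, (G.induce S).Connected → S ⊆ V₁ ∪ V₂ ∪ {v i} →
        (∃ x ∈ S, G.Adj (v i) x) → ∀ y ∈ S, ∀ hy : y ∈ V₁ ∪ V₂ ∪ {v i},
        (G.induce (V₁ ∪ V₂ ∪ {v i})).Reachable ⟨v i, hv1⟩ ⟨y, hy⟩ := by
      intro S hS hsub ⟨x, hx, hvx⟩ y hyS hy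
      have h1 : (G.induce (V₁ ∪ V₂ ∪ {v i})).Adj ⟨v i, hv1⟩ ⟨x, hsub hx⟩ := hvx
      exact h1.reachable.trans
        ((hS.preconnected ⟨x, hx⟩ ⟨y, hyS⟩).map (G.induceHomOfLE hsub).toHom)
    have hall : ∀ y : (V₁ ∪ V₂ ∪ {v i} : Set V),
        (G.induce (V₁ ∪ V₂ ∪ {v i})).Reachable ⟨v i, hv1⟩ y := by
      rintro ⟨y, hy⟩
      rcases id hy with (hy1 | hy2) | rfl
      · exact hreach h₁ (fun z hz => Or.inl (Or.inl hz)) (hadj i).1 y hy1 hy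
      · exact hreach h₂ (fun z hz => Or.inl (Or.inr hz)) (hadj i).2 y hy2 hy
      · exact Reachable.refl _
    refine ⟨fun x hx => ?_, ?_⟩
    · obtain ⟨j, rfl⟩ := hcover x fun h => hx (Or.inl h)
      obtain ⟨y, hy, hjy⟩ := (hadj j).1
      exact ⟨y, Or.inl (Or.inl hy), hjy⟩
    · have : Nonempty (V₁ ∪ V₂ ∪ {v i} : Set V) := ⟨⟨v i, hv1⟩⟩
      exact ⟨fun x y => (hall x).symm.trans (hall y)⟩
  have hcoal : ∀ i, IsCoalition G (V₁ ∪ V₂) {v i} := fun i =>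
    ⟨Set.disjoint_singleton_right.2 (hvV i), hU, hp i, hUv i⟩
  let P : Fin (K + 1) → Set V := Fin.cons (V₁ ∪ V₂) fun i => {v i}
  have hP0 : P 0 = V₁ ∪ V₂ := rfl
  have hPs : ∀ i : Fin K, P i.succ = {v i} := fun i => rfl
  have hPr : insert (V₁ ∪ V₂) (Set.range fun i => {v i}) = Set.range P :=
    (Fin.range_cons _ _).symm
  have hPinj : Function.Injective P := by
    refine Fin.cons_injective_iff.2 ⟨?_, fun i j hij => hv (Set.singleton_injective hij)⟩
    rintro ⟨i, hi⟩
    refine hvV i ?_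
    rw [← hi]
    rfl
  have hPadj : ∀ i j, (star (K + 1)).Adj i j ↔ IsCoalition G (P i) (P j) := by
    intro i j
    rw [star_adj]
    refine Fin.cases (Fin.cases ?_ (fun j => ?_) j)
      (fun i => Fin.cases ?_ (fun j => ?_) j) i
    · rw [hP0]
      exact iff_of_false (fun h => h.1 rfl) fun h => h.2.1 (by simpa using h.2.2.2)
    · rw [hP0, hPs]
      exact iff_of_true ⟨(Fin.succ_ne_zero j).symm, Or.inl rfl⟩ (hcoal j)
    · rw [hP0, hPs]
      refine iff_of_true ⟨Fin.succ_ne_zero i, Or.inr rfl⟩ ⟨(hcoal i).1.symm, hp i, hU, ?_⟩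
      rw [Set.union_comm]
      exact hUv i
    · rw [hPs, hPs]
      refine iff_of_false ?_ fun h => hpp i j h.2.2.2
      rintro ⟨-, h | h⟩ <;> simp at h
  refine ⟨(hUv ⟨0, hK⟩).connected, V₁, V₂, v, hd, h₁, h₂, hno, hv, hvV, hadj, hcoal, ⟨⟨?_, ?_⟩, ?_⟩,
    ?_⟩
  · rintro (h | ⟨i, hi⟩)
    · exact Set.notMem_empty a (h ▸ Or.inl ha)
    · exact Set.singleton_ne_empty _ hi
  · intro x
    by_cases hx : x ∈ V₁ ∪ V₂
    · refine ⟨V₁ ∪ V₂, ⟨Or.inl rfl, hx⟩, ?_⟩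
      rintro B ⟨rfl | ⟨i, rfl⟩, hB⟩
      · rfl
      · have hxi : x = v i := hB
        exact absurd (hxi ▸ hx) (hvV i)
    · obtain ⟨i, rfl⟩ := hcover x hx
      refine ⟨{v i}, ⟨Or.inr ⟨i, rfl⟩, rfl⟩, ?_⟩
      rintro B ⟨rfl | ⟨j, rfl⟩, hB⟩
      · exact absurd hB hx
      · have hij : v i = v j := hB
        rw [hij]
  · rintro A (rfl | ⟨i, rfl⟩)
    · exact Or.inr ⟨{v ⟨0, hK⟩}, Or.inr ⟨_, rfl⟩, hcoal _⟩
    · refine Or.inr ⟨V₁ ∪ V₂, Or.inl rfl, (hcoal i).1.symm, hp i, hU, ?_⟩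
      rw [Set.union_comm]
      exact hUv i
  · have := nonempty_iso_coalitionGraph_range hPinj hPadj
    rw [← hPr] at this
    exact this

theorem DefinesStarByPair.defines {k : ℕ} (hG : IsSubcubic G) (h : DefinesStarByPair G k) :
    Defines G (star k) := by
  obtain ⟨_, _, _, -, -, -, -, -, -, -, -, hπ, hiso⟩ := h
  exact ⟨hG, _, hπ, hiso⟩

/-- Two paths of order `N`, and `K` further vertices, the `i`-th of which is joined to the `i`-th
vertex of each path. -/
def twoPathsGraph (N K : ℕ) : SimpleGraph (Fin (2 * N + K)) :=
  SimpleGraph.fromRel fun x y =>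
    x.val + 1 = y.val ∧ y.val ≠ N ∧ y.val < 2 * N ∨
      2 * N ≤ y.val ∧ (x.val + 2 * N = y.val ∨ N ≤ x.val ∧ x.val + N = y.val)

theorem twoPathsGraph_adj {N K : ℕ} {x y : Fin (2 * N + K)} :
    (twoPathsGraph N K).Adj x y ↔ x.val ≠ y.val ∧
      ((x.val + 1 = y.val ∧ y.val ≠ N ∧ y.val < 2 * N ∨
        2 * N ≤ y.val ∧ (x.val + 2 * N = y.val ∨ N ≤ x.val ∧ x.val + N = y.val)) ∨
      (y.val + 1 = x.val ∧ x.val ≠ N ∧ x.val < 2 * N ∨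
        2 * N ≤ x.val ∧ (y.val + 2 * N = x.val ∨ N ≤ y.val ∧ y.val + N = x.val))) := by
  rw [twoPathsGraph, fromRel_adj, ne_eq, Fin.ext_iff]

theorem encard_neighborSet_twoPathsGraph_le {N K : ℕ} (hN : K ≤ N) (x : Fin (2 * N + K)) :
    ((twoPathsGraph N K).neighborSet x).encard ≤ 3 := by
  refine encard_neighborSet_le_three
    (if x.val < 2 * N then x + 1 else x - 2 * N)
    (if x.val < 2 * N then x - 1 else x - N)
    (if x.val < N then x + 2 * N else x + N) fun y h => ?_
  rw [twoPathsGraph_adj] at h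
  split_ifs <;> omega

theorem twoPathsGraph_spec {N K : ℕ} (hK : 0 < K) (hN : K + 4 ≤ N) :
    IsSubcubic (twoPathsGraph N K) ∧ DefinesStarByPair (twoPathsGraph N K) (K + 1) := by
  have hconn : ∀ lo hi, lo ≤ hi → (hi < N ∨ N ≤ lo) → hi < 2 * N →
      ((twoPathsGraph N K).induce {x | lo ≤ x.val ∧ x.val ≤ hi}).Connected := by
    intro lo hi h1 h2 h3
    have : Nonempty {x : Fin (2 * N + K) | lo ≤ x.val ∧ x.val ≤ hi} :=
      ⟨⟨⟨lo, by omega⟩, le_refl lo, h1⟩⟩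
    refine ⟨preconnected_induce_Icc fun x y hxy hx hy => ?_⟩
    rw [twoPathsGraph_adj]
    omega
  have key := definesStarByPair_of_cover (G := twoPathsGraph N K) hK
    (V₁ := {x | 0 ≤ x.val ∧ x.val ≤ N - 1}) (V₂ := {x | N ≤ x.val ∧ x.val ≤ 2 * N - 1})
    (v := fun i => ⟨2 * N + i.val, by omega⟩)
    (Set.disjoint_left.2 fun x h1 h2 => by
      have := h1.2
      have := h2.1
      omega)
    (hconn 0 (N - 1) (by omega) (by omega) (by omega))
    (hconn N (2 * N - 1) (by omega) (by omega) (by omega))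
    (fun x hx y hy h => by
      have := hx.2
      have h1 := hy.1
      have h2 := hy.2
      rw [twoPathsGraph_adj] at h
      omega)
    (fun i j h => Fin.ext (by simpa using h))
    (by
      rintro i (h | h)
      · have : 2 * N + i.val ≤ N - 1 := h.2
        omega
      · have : 2 * N + i.val ≤ 2 * N - 1 := h.2
        omega)
    (by
      intro x hx
      have hx' : 2 * N ≤ x.val := by
        by_contra hlt
        refine hx ?_
        rcases lt_or_ge x.val N with h | h
        · exact Or.inl ⟨Nat.zero_le _, by omega⟩
        · exact Or.inr ⟨h, by omega⟩
      exact ⟨⟨x.val - 2 * N, by omega⟩, Fin.ext (by dsimp only; omega)⟩)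
    (by
      intro i
      refine ⟨⟨⟨i.val, by omega⟩, ⟨Nat.zero_le _, by dsimp only; omega⟩, ?_⟩,
        ⟨⟨N + i.val, by omega⟩, ⟨by dsimp only; omega, by dsimp only; omega⟩, ?_⟩⟩
      · rw [twoPathsGraph_adj]
        dsimp only
        omega
      · rw [twoPathsGraph_adj]
        dsimp only
        omega)
    (by
      intro i j
      -- The last vertex of the first path: only the first `K < N` vertices of each path are joined
      -- to further vertices.
      refine ⟨⟨N - 1, by omega⟩, ?_, ?_, ?_, ?_⟩
      · intro h
        have := Fin.ext_iff.1 h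
        dsimp only at this
        omega
      · intro h
        have := Fin.ext_iff.1 h
        dsimp only at this
        omega
      · rw [twoPathsGraph_adj]
        dsimp only
        omega
      · rw [twoPathsGraph_adj]
        dsimp only
        omega)
  exact ⟨⟨key.1, encard_neighborSet_twoPathsGraph_le (by omega)⟩, key.2⟩

theorem starClasses_infinite {k : ℕ} (hk : 2 ≤ k) : (starClasses k).Infinite := by
  obtain ⟨K, rfl⟩ : ∃ K, k = K + 1 := ⟨k - 1, by omega⟩
  refine infinite_of_forall_exists fun N =>
    ⟨2 * (N + K + 4) + K, by omega, twoPathsGraph (N + K + 4) K, _, _, rfl, ?_⟩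
  exact twoPathsGraph_spec (by omega) (by omega)

theorem infinitelyDefined_star {k : ℕ} (hk : 2 ≤ k) : InfinitelyDefined (star k) := by
  refine (starClasses_infinite hk).mono ?_
  rintro _ ⟨n, G, rfl, hG, h⟩
  exact ⟨n, G, rfl, h.defines hG⟩

end Stars

end CoalitionGraphs

theorem theorem2 :
    -- the coalition graphs defined by finitely many subcubic graphs
    (CoalitionGraphs.FinitelyDefined.{u} (completeGraph (Fin 1)) ∧
      CoalitionGraphs.FinitelyDefined.{u} (CoalitionGraphs.edgeless 2) ∧
      CoalitionGraphs.FinitelyDefined.{u} (CoalitionGraphs.edgeless 3) ∧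
      CoalitionGraphs.FinitelyDefined.{u} (completeGraph (Fin 4)) ∧
      CoalitionGraphs.FinitelyDefined.{u} (CoalitionGraphs.edgeless 4) ∧
      CoalitionGraphs.FinitelyDefined.{u} (cycleGraph 5) ∧
      CoalitionGraphs.FinitelyDefined.{u} CoalitionGraphs.threeK2 ∧
      CoalitionGraphs.FinitelyDefined.{u} (completeBipartiteGraph (Fin 2) (Fin 3)) ∧
      CoalitionGraphs.FinitelyDefined.{u} (completeBipartiteGraph (Fin 3) (Fin 3))) ∧
    -- the coalition graphs defined by Möbius ladders
    (CoalitionGraphs.DefinedByMobiusLadders (cycleGraph 3) ∧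
      CoalitionGraphs.DefinedByMobiusLadders CoalitionGraphs.twoK2 ∧
      CoalitionGraphs.DefinedByMobiusLadders (pathGraph 4) ∧
      CoalitionGraphs.DefinedByMobiusLadders (cycleGraph 4) ∧
      CoalitionGraphs.DefinedByMobiusLadders CoalitionGraphs.C3e ∧
      CoalitionGraphs.DefinedByMobiusLadders CoalitionGraphs.K4MinusE ∧
      CoalitionGraphs.DefinedByMobiusLadders CoalitionGraphs.P2UnionP3 ∧
      CoalitionGraphs.DefinedByMobiusLadders CoalitionGraphs.S12 ∧
      CoalitionGraphs.DefinedByMobiusLadders (pathGraph 5) ∧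
      CoalitionGraphs.DefinedByMobiusLadders CoalitionGraphs.C3ee ∧
      CoalitionGraphs.DefinedByMobiusLadders CoalitionGraphs.C32e ∧
      CoalitionGraphs.DefinedByMobiusLadders CoalitionGraphs.S22) ∧
    -- the coalition graph defined by modified Möbius ladders
    CoalitionGraphs.DefinedByModifiedMobiusLadders CoalitionGraphs.C4e ∧
    -- the stars
    (∀ k : ℕ, 2 ≤ k →
      CoalitionGraphs.InfinitelyDefined (CoalitionGraphs.star k) ∧
        (CoalitionGraphs.starClasses k).Infinite) := by
  open CoalitionGraphs in
  exact ⟨⟨finitelyDefined_of_forall_not_adj (by decide) (by decide) (by decide),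
      finitelyDefined_of_forall_not_adj (by decide) (by decide) (by decide),
      finitelyDefined_of_forall_not_adj (by decide) (by decide) (by decide),
      finitelyDefined_of_card_le definingClasses_completeGraph_four_nonempty
        (fun _ _ _ h => h.card_le_of_completeGraph_four)
        (fun _ _ _ h => h.card_le_of_completeGraph_four),
      finitelyDefined_of_forall_not_adj (by decide) (by decide) (by decide),
      finitelyDefined_of_card_le definingClasses_cycleGraph_five_nonempty
        (fun _ _ _ h => h.card_le_of_cycleGraph_five)
        (fun _ _ _ h => h.card_le_of_cycleGraph_five),
      finitelyDefined_of_card_le definingClasses_threeK2_nonempty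
        (fun _ _ _ h => h.card_le_of_threeK2)
        (fun _ _ _ h => h.card_le_of_threeK2),
      finitelyDefined_of_card_le definingClasses_completeBipartiteGraph_two_three_nonempty
        (fun _ _ _ h => h.card_le_of_completeBipartiteGraph_two_three)
        (fun _ _ _ h => h.card_le_of_completeBipartiteGraph_two_three),
      finitelyDefined_of_card_le definingClasses_completeBipartiteGraph_three_three_nonempty
        (fun _ _ _ h => h.card_le_of_completeBipartiteGraph_three_three)
        (fun _ _ _ h => h.card_le_of_completeBipartiteGraph_three_three)⟩,
    ⟨definedByMobiusLadders_cycleGraph_three, definedByMobiusLadders_twoK2,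
      definedByMobiusLadders_pathGraph_four, definedByMobiusLadders_cycleGraph_four,
      definedByMobiusLadders_C3e, definedByMobiusLadders_K4MinusE,
      definedByMobiusLadders_P2UnionP3, definedByMobiusLadders_S12,
      definedByMobiusLadders_pathGraph_five, definedByMobiusLadders_C3ee,
      definedByMobiusLadders_C32e, definedByMobiusLadders_S22⟩,
    definedByModifiedMobiusLadders_C4e,
    fun _ hk => ⟨infinitelyDefined_star hk, starClasses_infinite hk⟩⟩
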